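/- **The game.** A group of $N=K+M$ voters, $K$ experts and $M$ non-experts, with $N$ and $K$ odd and $M\ge 1$ (hence $M\geq 2$ is even), chooses between two decisions. The state $\omega\in\{\omega_1,\omega_2\}$ has prior $\pi=\Pr(\omega_1)=1/2$. Every voter's payoff is $1$ if the decision matches the state and $0$ otherwise. Voter $i$ observes privately a binary signal that recommends the correct decision with probability $q_i$ in either state; given the state and the precisions, signals are independent. Every expert has the known precision $q_e=p$ with $1/2<p<1$. Each non-expert's precision is private information, drawn independently from a continuous (atomless) distribution $F$ with support $[1/2,p]$. Who is an expert is commonly known. Having observed her precision and signal, each voter simultaneously either votes for one of the two decisions, or delegates to the category of experts or to that of non-experts (possible if the category contains another voter). A delegated vote goes to a voter drawn uniformly, independently across delegators, among the other members of the category. A voter who votes casts one vote plus all the votes delegated to her, directly or through several steps. If delegations are circular, then, as long as this is possible, a link is drawn uniformly among the links of the circular flows (including the links of voters delegating into them) whose selected category has a member outside the circular flow, and the whole flow is reassigned to a uniformly drawn such member. Votes in a circular flow for which this is impossible are not cast. The decision with more votes is taken; a tie (in particular, no vote cast) is broken by a fair coin. Strategies are measurable maps from precision and signal to probability distributions over the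 available actions. **Theorem.** For all such $N$, $K$, $p$ and $F$ the game has a strategy profile such that 1. it is a Perfect Bayesian equilibrium: for every voter, every precision (in $[1/2,p]$ for non-experts, equal to $p$ for experts) and every signal, each action played with positive probability is optimal among all available actions, given the posterior beliefs from Bayes' rule and the others' strategies; 2. no voter's strategy is weakly dominated by another of her strategies (in ex ante expected payoff, against all profiles of the others); 3. voters of the same category use the same strategy, every voter who votes votes according to her signal, and delegation probabilities do not depend on the content of the signal; 4. some voter delegates with strictly positive ex ante probability; 5. the ex ante probability of a correct decision is strictly higher than under sincere majority voting, in which all $N$ voters cast one vote according to their signals. -/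

import Mathlib

open MeasureTheory
open scoped BigOperators

namespace LiquidDemocracy

noncomputable section

/-! States of the world, decisions and signals are all `Bool`: decision `d` is correct in
state `ω` iff `d = ω`, and signal `σ` recommends decision `σ`. -/

/-- The two publicly known categories of voters. -/
inductive Kind
  | expert
  | nonExpert
  deriving DecidableEq

instance : Fintype Kind :=
  ⟨{Kind.expert, Kind.nonExpert}, fun k => by cases k <;> simp⟩

/-- A voter either casts her vote for a decision, or delegates it to a category of voters. -/
inductive Action
  | vote (d : Bool)
  | delegate (k : Kind)
  deriving DecidableEq

instance : Fintype Action :=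
  ⟨{Action.vote true, Action.vote false, Action.delegate Kind.expert,
    Action.delegate Kind.nonExpert}, fun x => by
      rcases x with (_ | _) | (_ | _) <;> simp⟩

/-- The electorate: `K` experts and `M` non-experts. -/
abbrev Voter (K M : ℕ) := Fin K ⊕ Fin M

variable {K M : ℕ}

/-- The category of a voter. -/
def kind : Voter K M → Kind
  | Sum.inl _ => Kind.expert
  | Sum.inr _ => Kind.nonExpert

/-- The voters of category `k` other than `v`. -/
def others (v : Voter K M) (k : Kind) : Finset (Voter K M) :=
  Finset.univ.filter fun w => w ≠ v ∧ kind w = k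

/-- Delegating to a category is possible when it contains somebody else. -/
def Available (v : Voter K M) : Action → Prop
  | Action.vote _ => True
  | Action.delegate k => (others v k).Nonempty

/-! ### From actions to the decision

A delegation pattern `t` records for each voter the voter who currently holds her delegation,
or `none` if she votes herself. -/

/-- The possible targets of `v`'s delegation under action `x`. -/
def targets (v : Voter K M) : Action → Finset (Option (Voter K M))
  | Action.vote _ => {none}
  | Action.delegate k => (others v k).map Function.Embedding.some

/-- The delegation patterns that may be drawn when the actions are `a`. The uniform
distribution on this product set makes the draws of distinct voters independent, and each of
them uniform over the other voters in the category selected. -/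
def draws (a : Voter K M → Action) : Finset (Voter K M → Option (Voter K M)) :=
  Fintype.piFinset fun v => targets v (a v)

/-- Under `t`, votes held by `v` are passed on, in zero or more steps, to `w`. -/
def Flows (t : Voter K M → Option (Voter K M)) : Voter K M → Voter K M → Prop :=
  Relation.ReflTransGen fun x y => t x = some y

/-- The vote of `v` ends in a circular delegation flow: it never reaches somebody who votes. -/
def Trapped (t : Voter K M → Option (Voter K M)) (v : Voter K M) : Prop :=
  ∀ w, Flows t v w → t w ≠ none

open Classical in
/-- For a trapped `c`, the members of the circular flow containing `c`, including the voters
who delegate into it. -/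
def circle (t : Voter K M → Option (Voter K M)) (c : Voter K M) : Finset (Voter K M) :=
  Finset.univ.filter fun w => ∃ x, Flows t c x ∧ Flows t w x

open Classical in
/-- The voters, in the category selected by `c`, to whom the circular flow through `c` can be
redirected if the link chosen is that of `c`. -/
def redirections (a : Voter K M → Action) (t : Voter K M → Option (Voter K M))
    (c : Voter K M) : Finset (Voter K M) :=
  Finset.univ.filter fun w => a c = Action.delegate (kind w) ∧ w ∉ circle t c

open Classical in
/-- The links of circular flows that can be redirected. -/
def links (a : Voter K M → Action) (t : Voter K M → Option (Voter K M)) :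
    Finset (Voter K M) :=
  Finset.univ.filter fun c => Trapped t c ∧ (redirections a t c).Nonempty

/-- All votes in the circular flow through `c` are handed to `w`. -/
def redirect (t : Voter K M → Option (Voter K M)) (c w : Voter K M) :
    Voter K M → Option (Voter K M) :=
  fun v => if v ∈ circle t c then some w else t v

/-- The number of votes cast by `w`, if she votes: her own and those delegated to her,
directly or in several steps. -/
def weight (t : Voter K M → Option (Voter K M)) (w : Voter K M) : ℕ :=
  open Classical in (Finset.univ.filter fun v => Flows t v w).card

/-- The number of votes cast for decision `d`. -/
def tally (a : Voter K M → Action) (t : Voter K M → Option (Voter K M)) (d : Bool) : ℕ :=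
  ∑ w ∈ Finset.univ.filter (fun w => a w = Action.vote d), weight t w

/-- The probability that the majority of the votes cast selects `d`; a tie (in particular the
case in which no vote is cast) is resolved by a fair coin. -/
def winProb (a : Voter K M → Action) (t : Voter K M → Option (Voter K M)) (d : Bool) : ℝ :=
  if tally a t (!d) < tally a t d then 1
  else if tally a t d < tally a t (!d) then 0
  else 1 / 2

/-- The probability of decision `d` starting from pattern `t`, after at most `n` rounds of
resolution of circular flows. In a round, a link is chosen uniformly among those that can be
redirected, and its circular flow is handed to a uniformly chosen admissible voter. A circular
flow none of whose links can be redirected casts no vote. -/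
def resolvedWinProb (a : Voter K M → Action) (d : Bool) :
    ℕ → (Voter K M → Option (Voter K M)) → ℝ
  | 0, t => winProb a t d
  | n + 1, t =>
    open Classical in
    if (links a t).Nonempty then
      𝔼 c ∈ links a t, 𝔼 w ∈ redirections a t c, resolvedWinProb a d n (redirect t c w)
    else winProb a t d

/-- The probability that the group takes decision `d` when the actions are `a`. Every round
lowers the number of circular flows by one, so `K + M` rounds are enough. -/
def decisionProb (a : Voter K M → Action) (d : Bool) : ℝ :=
  𝔼 t ∈ draws a, resolvedWinProb a d (K + M) t

/-! ### Information, strategies and payoffs -/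

/-- The prior, with `π` the probability of the first state. -/
def prior (π : ℝ) (ω : Bool) : ℝ := if ω then π else 1 - π

/-- The probability of signal `σ` of precision `q` in state `ω`. -/
def signalProb (q : ℝ) (ω σ : Bool) : ℝ := if σ = ω then q else 1 - q

/-- The law of the precision: `p` for an expert, distributed as `F` for a non-expert. -/
def precisionLaw (p : ℝ) (F : Measure ℝ) : Kind → Measure ℝ
  | Kind.expert => Measure.dirac p
  | Kind.nonExpert => F

/-- The possible precisions. -/
def precisions (p : ℝ) : Kind → Set ℝ
  | Kind.expert => {p}
  | Kind.nonExpert => Set.Icc (1 / 2) p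

/-- A (behavioural) strategy of voter `v`: `prob q σ x` is the probability of action `x`
after a signal `σ` of precision `q`. -/
structure Strategy (v : Voter K M) where
  prob : ℝ → Bool → Action → ℝ
  nonneg : ∀ q σ x, 0 ≤ prob q σ x
  sum_eq_one : ∀ q σ, ∑ x, prob q σ x = 1
  available : ∀ q σ x, ¬ Available v x → prob q σ x = 0
  measurable : ∀ σ x, Measurable fun q => prob q σ x

/-- A profile of strategies. -/
abbrev Profile (K M : ℕ) := ∀ v : Voter K M, Strategy v

/-- The action probabilities prescribed by a profile. -/
def behaviour (s : Profile K M) : Voter K M → ℝ → Bool → Action → ℝ := fun v => (s v).prob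

/-- The probability of a correct decision in state `ω` under action probabilities `b`.
Precisions are independent and, given the state, so are the signals. -/
def stateValue (p : ℝ) (F : Measure ℝ) (b : Voter K M → ℝ → Bool → Action → ℝ)
    (ω : Bool) : ℝ :=
  ∫ q : Voter K M → ℝ,
    ∑ σ : Voter K M → Bool, (∏ v, signalProb (q v) ω (σ v)) *
      ∑ a : Voter K M → Action, (∏ v, b v (q v) (σ v) (a v)) * decisionProb a ω
    ∂(Measure.pi fun v => precisionLaw p F (kind v))

/-- The ex ante expected payoff, i.e. the ex ante probability of a correct decision. -/
def expectedUtility (π p : ℝ) (F : Measure ℝ) (s : Profile K M) : ℝ :=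
  ∑ ω, prior π ω * stateValue p F (behaviour s) ω

/-- The ex ante probability of a correct decision under sincere majority voting. -/
def majorityVotingUtility (K M : ℕ) (π p : ℝ) (F : Measure ℝ) : ℝ :=
  ∑ ω, prior π ω *
    ∫ q : Voter K M → ℝ,
      ∑ σ : Voter K M → Bool, (∏ v, signalProb (q v) ω (σ v)) *
        (if K + M < 2 * (Finset.univ.filter fun v => σ v = ω).card then 1 else 0)
      ∂(Measure.pi fun v => precisionLaw p F (kind v))

/-- The posterior probability of state `ω` after a signal `σ` of precision `q`. -/
def posterior (π q : ℝ) (σ ω : Bool) : ℝ :=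
  prior π ω * signalProb q ω σ / ∑ ω', prior π ω' * signalProb q ω' σ

/-- The expected payoff of action `x` to voter `v` who has received a signal `σ` of precision
`q`, when the other voters follow `s`. -/
def interimUtility (π p : ℝ) (F : Measure ℝ) (s : Profile K M) (v : Voter K M)
    (q : ℝ) (σ : Bool) (x : Action) : ℝ :=
  ∑ ω, posterior π q σ ω *
    stateValue p F (Function.update (behaviour s) v fun _ _ => Pi.single x 1) ω

/-! ### Equilibrium -/

/-- Perfect Bayesian equilibrium: at every information set, i.e. for every voter, precision and
signal, the actions played are optimal given the beliefs derived by Bayes' rule. -/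
def IsPerfectBayesian (π p : ℝ) (F : Measure ℝ) (s : Profile K M) : Prop :=
  ∀ v, ∀ q ∈ precisions p (kind v), ∀ σ x y, 0 < (s v).prob q σ x → Available v y →
    interimUtility π p F s v q σ y ≤ interimUtility π p F s v q σ x

/-- `s'` weakly dominates `s₀` as a strategy of `v`. -/
def WeaklyDominates (π p : ℝ) (F : Measure ℝ) (v : Voter K M) (s' s₀ : Strategy v) : Prop :=
  (∀ r : Profile K M, expectedUtility π p F (Function.update r v s₀) ≤
      expectedUtility π p F (Function.update r v s')) ∧
    ∃ r : Profile K M, expectedUtility π p F (Function.update r v s₀) <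
      expectedUtility π p F (Function.update r v s')

/-- No voter uses a weakly dominated strategy. -/
def IsUndominated (π p : ℝ) (F : Measure ℝ) (s : Profile K M) : Prop :=
  ∀ v, ¬ ∃ s' : Strategy v, WeaklyDominates π p F v s' (s v)

/-- Voters of the same category follow the same strategy. -/
def IsSemiSymmetric (p : ℝ) (s : Profile K M) : Prop :=
  ∀ v w, kind v = kind w → ∀ q ∈ precisions p (kind v), ∀ σ x,
    (s v).prob q σ x = (s w).prob q σ x

/-- Voters who vote follow their signals. -/
def IsSincere (p : ℝ) (s : Profile K M) : Prop :=
  ∀ v, ∀ q ∈ precisions p (kind v), ∀ σ, (s v).prob q σ (Action.vote (!σ)) = 0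

/-- The delegation choice does not depend on the content of the signal. -/
def IsSignalSymmetric (p : ℝ) (s : Profile K M) : Prop :=
  ∀ v, ∀ q ∈ precisions p (kind v), ∀ σ σ' k,
    (s v).prob q σ (Action.delegate k) = (s v).prob q σ' (Action.delegate k)

/-- The notion of equilibrium selected. -/
structure IsEquilibrium (π p : ℝ) (F : Measure ℝ) (s : Profile K M) : Prop where
  perfectBayesian : IsPerfectBayesian π p F s
  undominated : IsUndominated π p F s
  semiSymmetric : IsSemiSymmetric p s
  sincere : IsSincere p s
  signalSymmetric : IsSignalSymmetric p s

/-- The ex ante probability that `v` delegates. -/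
def delegationProb (π p : ℝ) (F : Measure ℝ) (s : Profile K M) (v : Voter K M) : ℝ :=
  ∑ ω, prior π ω *
    ∫ q, ∑ σ, signalProb q ω σ * ∑ k, (s v).prob q σ (Action.delegate k)
      ∂(precisionLaw p F (kind v))

end

end LiquidDemocracy

open LiquidDemocracy

/-!
The game has common interests, so equilibria can be found by maximizing the common payoff. The
maximization is restricted to pairs of delegation *rules* (`IsRule`): one rule for each category,
prescribing delegation probabilities as a function of the precision only, with sincere voting
otherwise. Such profiles treat the two states alike, and the payoff of a profile is a multilinear
function `payoff` of the voters' action probabilities in the state `true`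
(`Setting.stateValue_eq`, `payoff_flip`).

*Existence.* For a given frequency of voting, non-experts do best to vote exactly from some
precision on (`Setting.integral_voteProb_mul_le`), and the precision of experts is known; so
finitely many parameters in a compact set suffice, and the payoff is continuous in them because `F`
has no atoms. Among the optimal pairs, one that votes most often is selected
(`Setting.exists_isOptimal`).

*Equilibrium.* If a rule were profitable for one voter, moving her whole category slightly towards
it would raise the payoff to first order (`payoff_update_le_of_forall_mix`). Hence the optimal rules
are best responses at almost every precision. By continuity of the interim payoff, and since `F` has
full support, they are best responses at every precision (`Setting.nonExpert_best`,
`Setting.isPerfectBayesian`).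

*Undominated.* Suppose a strategy dominates the rule of a voter. Its sincere average can be adopted
by her category, voter by voter, without loss (`Setting.ruleValue_le_of_weaklyDominates`), so by the
choice among optimal pairs it does not vote more often. Comparing with the profiles in which all
others vote sincerely, or all against their signals, it has at least the same surplus of right over
wrong votes (`Setting.vote_sub_le_of_dominates`). As a cutoff rule has the largest surplus for its
frequency of voting, the two strategies lead to the same votes, averaged over the two states, and
differ only in how they delegate (`Setting.vote_sub_le_paramRules`). With this averaging, reversing
the votes of all others reverses the comparison between them, so that neither dominates the other
(`Setting.not_weaklyDominates`).

*Improvement.* If never delegating were optimal, then a non-expert of precision `1 / 2`, whose vote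
is uninformative, would not prefer to delegate to experts. But she does: her action matters when the
others are evenly split, and then a random expert is more likely to be right than wrong, as experts
are better informed than non-experts (`payoff_sincere_delegate_gt`). Thus the optimum is strictly
better than majority voting, and some voter delegates.
-/

namespace LiquidDemocracy

variable {K M : ℕ}

/-! ### The decision rule for fixed actions -/

/-- The action with the recommended decision reversed; delegations are kept. -/
def flipAction : Action → Action
  | Action.vote d => Action.vote (!d)
  | Action.delegate k => Action.delegate k

@[simp] lemma flipAction_vote (d : Bool) : flipAction (.vote d) = .vote (!d) := rfl

@[simp] lemma flipAction_delegate (k : Kind) : flipAction (.delegate k) = .delegate k := rfl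

@[simp] lemma flipAction_flipAction (x : Action) : flipAction (flipAction x) = x := by
  cases x <;> simp

/-- `flipAction` as a permutation of the actions. -/
def flipEquiv : Action ≃ Action :=
  ⟨flipAction, flipAction, flipAction_flipAction, flipAction_flipAction⟩

lemma sum_flipAction (f : Action → ℝ) : ∑ x, f (flipAction x) = ∑ x, f x :=
  Equiv.sum_comp flipEquiv f

lemma sum_action (f : Action → ℝ) :
    ∑ x, f x = f (.vote true) + f (.vote false) + f (.delegate .expert)
      + f (.delegate .nonExpert) := by
  change ∑ x ∈ ({Action.vote true, Action.vote false, Action.delegate Kind.expert,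
    Action.delegate Kind.nonExpert} : Finset Action), f x = _
  rw [Finset.sum_insert (by decide), Finset.sum_insert (by decide), Finset.sum_insert (by decide),
    Finset.sum_singleton]
  ring

lemma sum_kind (f : Kind → ℝ) : ∑ k, f k = f .expert + f .nonExpert := by
  change ∑ x ∈ ({Kind.expert, Kind.nonExpert} : Finset Kind), f x = _
  rw [Finset.sum_insert (by decide), Finset.sum_singleton]

/-- Two action profiles with the same delegations. -/
def SameDelegations (a b : Voter K M → Action) : Prop :=
  ∀ v k, a v = .delegate k ↔ b v = .delegate k

lemma SameDelegations.draws_eq {a b : Voter K M → Action} (h : SameDelegations a b) :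
    draws a = draws b := by
  unfold draws
  congr 1
  funext v
  have hv := h v
  cases ha : a v with
  | vote d =>
    cases hb : b v with
    | vote d' => rfl
    | delegate k => exact absurd ((hv k).2 hb) (by simp [ha])
  | delegate k => rw [(hv k).1 ha]

lemma SameDelegations.redirections_eq {a b : Voter K M → Action} (h : SameDelegations a b)
    (t : Voter K M → Option (Voter K M)) (c : Voter K M) :
    redirections a t c = redirections b t c := by
  classical
  ext w
  simp only [redirections, Finset.mem_filter, Finset.mem_univ, true_and, h c]

lemma SameDelegations.links_eq {a b : Voter K M → Action} (h : SameDelegations a b)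
    (t : Voter K M → Option (Voter K M)) : links a t = links b t := by
  classical
  ext w
  simp only [links, Finset.mem_filter, Finset.mem_univ, true_and, h.redirections_eq]

/-- The routing of delegated votes depends on the delegations only, so that comparisons between
final counts carry over to decision probabilities. -/
lemma SameDelegations.decisionProb_le {a b : Voter K M → Action} (h : SameDelegations a b)
    {d d' : Bool} (hw : ∀ t, winProb a t d ≤ winProb b t d') :
    decisionProb a d ≤ decisionProb b d' := by
  have key : ∀ n t, resolvedWinProb a d n t ≤ resolvedWinProb b d' n t := by
    intro n
    induction n with
    | zero => exact hw
    | succ n ih =>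
      intro t
      simp only [resolvedWinProb, h.links_eq]
      split_ifs
      · refine Finset.expect_le_expect fun c _ => ?_
        rw [h.redirections_eq]
        exact Finset.expect_le_expect fun w _ => ih _
      · exact hw t
  unfold decisionProb
  rw [h.draws_eq]
  exact Finset.expect_le_expect fun t _ => key _ t

lemma tally_flip (a : Voter K M → Action) (t : Voter K M → Option (Voter K M)) (d : Bool) :
    tally (fun v => flipAction (a v)) t (!d) = tally a t d := by
  unfold tally
  congr 1
  ext w
  simp only [Finset.mem_filter, Finset.mem_univ, true_and]
  cases a w <;> simp

lemma decisionProb_flip (a : Voter K M → Action) (d : Bool) :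
    decisionProb (fun v => flipAction (a v)) (!d) = decisionProb a d := by
  have h : SameDelegations (fun v => flipAction (a v)) a := by
    intro v k
    change flipAction (a v) = _ ↔ _
    cases a v <;> simp
  have hw : ∀ t, winProb (fun v => flipAction (a v)) t (!d) = winProb a t d := by
    intro t
    have h' := tally_flip a t (!d)
    rw [Bool.not_not] at h'
    simp only [winProb, Bool.not_not, tally_flip, h']
  refine le_antisymm (h.decisionProb_le fun t => (hw t).le) (SameDelegations.decisionProb_le ?_
    fun t => (hw t).ge)
  exact fun v k => (h v k).symm

lemma winProb_add (a : Voter K M → Action) (t : Voter K M → Option (Voter K M)) :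
    winProb a t true + winProb a t false = 1 := by
  simp only [winProb, Bool.not_true, Bool.not_false]
  split_ifs <;> first | omega | norm_num

lemma draws_nonempty {a : Voter K M → Action} (ha : ∀ v, Available v (a v)) :
    (draws a).Nonempty := by
  refine Fintype.piFinset_nonempty.2 fun v => ?_
  have := ha v
  cases h : a v with
  | vote d => simp [targets]
  | delegate k =>
    rw [h] at this
    simpa [targets, Available] using this

/-- One of the two decisions is taken. If some action were unavailable, there would be no
delegation pattern to average over and both probabilities would be zero. -/
lemma decisionProb_add {a : Voter K M → Action} (ha : ∀ v, Available v (a v)) :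
    decisionProb a true + decisionProb a false = 1 := by
  have key : ∀ n t, resolvedWinProb a true n t + resolvedWinProb a false n t = 1 := by
    intro n
    induction n with
    | zero => exact winProb_add a
    | succ n ih =>
      intro t
      simp only [resolvedWinProb]
      split_ifs with hl
      · rw [← Finset.expect_add_distrib]
        refine (Finset.expect_congr rfl fun c hc => ?_).trans (Finset.expect_const hl 1)
        rw [← Finset.expect_add_distrib]
        have hr : (redirections a t c).Nonempty := by
          classical
          simp only [links, Finset.mem_filter] at hc
          exact hc.2.2
        exact (Finset.expect_congr rfl fun w _ => ih _).trans (Finset.expect_const hr 1)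
      · exact winProb_add a t
  unfold decisionProb
  rw [← Finset.expect_add_distrib]
  exact (Finset.expect_congr rfl fun t _ => key _ t).trans
    (Finset.expect_const (draws_nonempty ha) 1)

/-- Moving one's own votes from the wrong to the right decision helps the right decision. -/
lemma decisionProb_update_mono (a : Voter K M → Action) (v : Voter K M) (d : Bool) :
    decisionProb (Function.update a v (.vote !d)) d ≤
      decisionProb (Function.update a v (.vote d)) d := by
  refine SameDelegations.decisionProb_le ?_ fun t => ?_
  · intro w k
    by_cases h : w = v
    · subst h; simp
    · simp [h]
  · have h1 : tally (Function.update a v (.vote !d)) t d ≤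
        tally (Function.update a v (.vote d)) t d := by
      refine Finset.sum_le_sum_of_subset fun w => ?_
      simp only [Finset.mem_filter, Finset.mem_univ, true_and]
      by_cases h : w = v
      · subst h; simp
      · simp [h]
    have h2 : tally (Function.update a v (.vote d)) t (!d) ≤
        tally (Function.update a v (.vote !d)) t (!d) := by
      refine Finset.sum_le_sum_of_subset fun w => ?_
      simp only [Finset.mem_filter, Finset.mem_univ, true_and]
      by_cases h : w = v
      · subst h; simp
      · simp [h]
    unfold winProb
    split_ifs <;> first | omega | norm_num

/-! ### Permuting the voters within their categories -/

/-- The delegation pattern obtained by renaming the voters. -/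
def relabel (e : Equiv.Perm (Voter K M)) :
    (Voter K M → Option (Voter K M)) ≃ (Voter K M → Option (Voter K M)) :=
  Equiv.arrowCongr e (Equiv.optionCongr e)

lemma relabel_apply (e : Equiv.Perm (Voter K M)) (t : Voter K M → Option (Voter K M))
    (v : Voter K M) : relabel e t (e v) = (t v).map e := by
  simp [relabel]

lemma relabel_eq_none (e : Equiv.Perm (Voter K M)) (t : Voter K M → Option (Voter K M))
    (v : Voter K M) : relabel e t (e v) = none ↔ t v = none := by
  simp [relabel_apply]

lemma relabel_eq_some (e : Equiv.Perm (Voter K M)) (t : Voter K M → Option (Voter K M))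
    (v w : Voter K M) : relabel e t (e v) = some (e w) ↔ t v = some w := by
  simp [relabel_apply]

lemma flows_relabel (e : Equiv.Perm (Voter K M)) (t : Voter K M → Option (Voter K M))
    (x y : Voter K M) : Flows (relabel e t) (e x) (e y) ↔ Flows t x y := by
  constructor
  · intro h
    have := Relation.ReflTransGen.lift (p := fun x y => t x = some y) e.symm (fun a b hab => by
      have := relabel_eq_some e t (e.symm a) (e.symm b)
      simp only [Equiv.apply_symm_apply] at this
      exact this.1 hab) _ _ h
    simpa [Function.onFun, Flows] using this
  · intro h
    exact Relation.ReflTransGen.lift e (fun a b hab => (relabel_eq_some e t a b).2 hab) _ _ h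

lemma mem_circle_relabel (e : Equiv.Perm (Voter K M)) (t : Voter K M → Option (Voter K M))
    (c w : Voter K M) : e w ∈ circle (relabel e t) (e c) ↔ w ∈ circle t c := by
  classical
  simp only [circle, Finset.mem_filter, Finset.mem_univ, true_and]
  rw [← e.exists_congr_right]
  simp only [flows_relabel]

lemma mem_others_relabel {e : Equiv.Perm (Voter K M)} (he : ∀ v, kind (e v) = kind v)
    (v w : Voter K M) (k : Kind) : e w ∈ others (e v) k ↔ w ∈ others v k := by
  simp [others, he]

lemma mem_redirections_relabel {e : Equiv.Perm (Voter K M)} (he : ∀ v, kind (e v) = kind v)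
    (a : Voter K M → Action) (t : Voter K M → Option (Voter K M)) (c w : Voter K M) :
    e w ∈ redirections (a ∘ e.symm) (relabel e t) (e c) ↔ w ∈ redirections a t c := by
  classical
  simp [redirections, he, mem_circle_relabel]

lemma trapped_relabel (e : Equiv.Perm (Voter K M)) (t : Voter K M → Option (Voter K M))
    (v : Voter K M) : Trapped (relabel e t) (e v) ↔ Trapped t v := by
  unfold Trapped
  rw [← e.forall_congr_right]
  simp only [flows_relabel, ne_eq, relabel_eq_none]

lemma mem_links_relabel {e : Equiv.Perm (Voter K M)} (he : ∀ v, kind (e v) = kind v)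
    (a : Voter K M → Action) (t : Voter K M → Option (Voter K M)) (c : Voter K M) :
    e c ∈ links (a ∘ e.symm) (relabel e t) ↔ c ∈ links a t := by
  classical
  simp only [links, Finset.mem_filter, Finset.mem_univ, true_and, trapped_relabel]
  refine and_congr_right fun _ => ?_
  unfold Finset.Nonempty
  rw [← e.exists_congr_right]
  simp only [mem_redirections_relabel he]

lemma redirect_relabel (e : Equiv.Perm (Voter K M)) (t : Voter K M → Option (Voter K M))
    (c w : Voter K M) :
    redirect (relabel e t) (e c) (e w) = relabel e (redirect t c w) := by
  funext v
  obtain ⟨v, rfl⟩ := e.surjective v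
  rw [relabel_apply]
  simp only [redirect, mem_circle_relabel]
  split_ifs
  · rfl
  · rw [relabel_apply]

lemma weight_relabel (e : Equiv.Perm (Voter K M)) (t : Voter K M → Option (Voter K M))
    (w : Voter K M) : weight (relabel e t) (e w) = weight t w := by
  classical
  unfold weight
  symm
  refine Finset.card_equiv e fun v => ?_
  simp [flows_relabel]

lemma tally_relabel (e : Equiv.Perm (Voter K M)) (a : Voter K M → Action)
    (t : Voter K M → Option (Voter K M)) (d : Bool) :
    tally (a ∘ e.symm) (relabel e t) d = tally a t d := by
  unfold tally
  symm
  refine Finset.sum_equiv e (fun v => ?_) fun v _ => (weight_relabel e t v).symm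
  simp

lemma decisionProb_relabel {e : Equiv.Perm (Voter K M)} (he : ∀ v, kind (e v) = kind v)
    (a : Voter K M → Action) (d : Bool) : decisionProb (a ∘ e.symm) d = decisionProb a d := by
  have hw : ∀ t, winProb (a ∘ e.symm) (relabel e t) d = winProb a t d := by
    intro t
    simp only [winProb, tally_relabel]
  have key : ∀ n t, resolvedWinProb a d n t =
      resolvedWinProb (a ∘ e.symm) d n (relabel e t) := by
    intro n
    induction n with
    | zero => exact fun t => (hw t).symm
    | succ n ih =>
      intro t
      have hne : (links (a ∘ e.symm) (relabel e t)).Nonempty ↔ (links a t).Nonempty := by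
        unfold Finset.Nonempty
        rw [← e.exists_congr_right]
        simp only [mem_links_relabel he]
      simp only [resolvedWinProb, hne]
      split_ifs
      · refine Finset.expect_equiv e (fun c => (mem_links_relabel he a t c).symm) fun c _ => ?_
        refine Finset.expect_equiv e
          (fun w => (mem_redirections_relabel he a t c w).symm) fun w _ => ?_
        rw [ih, redirect_relabel]
      · exact (hw t).symm
  unfold decisionProb
  symm
  refine Finset.expect_equiv (relabel e) (fun t => ?_) fun t _ => key _ t
  simp only [draws, Fintype.mem_piFinset]
  refine Iff.trans (forall_congr' fun v => ?_) e.forall_congr_right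
  rw [relabel_apply]
  simp only [Function.comp_apply, Equiv.symm_apply_apply]
  cases a v with
  | vote d => simp [targets]
  | delegate k =>
    cases t v with
    | none => simp [targets]
    | some w =>
      have := mem_others_relabel he v w k
      simp only [targets, Finset.mem_map, Option.map_some, Function.Embedding.some_apply,
        Option.some.injEq, exists_eq_right]
      exact this.symm

/-! ### Voting without delegation, and with a single delegation -/

/-- The probability that decision `d` wins when every voter casts one vote, according to `τ`. -/
noncomputable def majority (τ : Voter K M → Bool) (d : Bool) : ℝ :=
  if (Finset.univ.filter fun v => τ v = !d).card < (Finset.univ.filter fun v => τ v = d).card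
  then 1
  else if (Finset.univ.filter fun v => τ v = d).card < (Finset.univ.filter fun v => τ v = !d).card
  then 0 else 1 / 2

lemma resolvedWinProb_of_not_trapped (a : Voter K M → Action) (d : Bool)
    (t : Voter K M → Option (Voter K M)) (ht : ∀ v, ¬ Trapped t v) (n : ℕ) :
    resolvedWinProb a d n t = winProb a t d := by
  classical
  cases n with
  | zero => rfl
  | succ n =>
    have : ¬ (links a t).Nonempty := by
      rintro ⟨c, hc⟩
      simp only [links, Finset.mem_filter] at hc
      exact ht c hc.2.1
    simp only [resolvedWinProb, if_neg this]

/-- If every vote `x` is finally cast by `dest x`, the tallies count the votes of the `dest x`. -/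
lemma tally_of_destination (a : Voter K M → Action) (t : Voter K M → Option (Voter K M))
    (dest : Voter K M → Voter K M)
    (h : ∀ x u d, a u = .vote d → (Flows t x u ↔ u = dest x)) (d : Bool) :
    tally a t d = (Finset.univ.filter fun x => a (dest x) = .vote d).card := by
  classical
  unfold tally weight
  simp only [Finset.card_filter]
  rw [Finset.sum_comm]
  refine Finset.sum_congr rfl fun x _ => ?_
  rw [Finset.sum_congr rfl (g := fun u => if u = dest x then 1 else 0)]
  · simp
  · intro u hu
    simp only [Finset.mem_filter, Finset.mem_univ, true_and] at hu
    simp only [h x u d hu]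

lemma winProb_of_destination (a : Voter K M → Action) (t : Voter K M → Option (Voter K M))
    (dest : Voter K M → Voter K M)
    (h : ∀ x u d, a u = .vote d → (Flows t x u ↔ u = dest x))
    (τ : Voter K M → Bool) (hτ : ∀ x, a (dest x) = .vote (τ x)) (d : Bool) :
    winProb a t d = majority τ d := by
  simp only [winProb, majority, tally_of_destination a t dest h, hτ, Action.vote.injEq]

lemma decisionProb_vote (τ : Voter K M → Bool) (d : Bool) :
    decisionProb (fun v => .vote (τ v)) d = majority τ d := by
  have hd : draws (fun v => Action.vote (τ v)) = {fun _ => none} := by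
    ext t
    simp [draws, targets, funext_iff]
  unfold decisionProb
  rw [hd, Finset.expect_singleton, resolvedWinProb_of_not_trapped]
  · refine winProb_of_destination _ _ id (fun x u d _ => ?_) τ (fun x => rfl) d
    constructor
    · intro h
      rcases Relation.ReflTransGen.cases_head h with h | ⟨c, hc, -⟩
      · exact h.symm
      · simp at hc
    · rintro rfl
      exact Relation.ReflTransGen.refl
  · exact fun v hv => hv v Relation.ReflTransGen.refl rfl

/-- When all others vote, delegating amounts to copying the vote of a random member of the
category selected. -/
lemma decisionProb_update_delegate (τ : Voter K M → Bool) (v : Voter K M) (k : Kind) (d : Bool) :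
    decisionProb (Function.update (fun w => .vote (τ w)) v (.delegate k)) d =
      Finset.expect (others v k) fun w => majority (Function.update τ v (τ w)) d := by
  classical
  unfold decisionProb
  symm
  refine Finset.expect_nbij (fun w => Function.update (fun _ => none) v (some w)) ?_ ?_ ?_ ?_
  · intro w hw
    refine Fintype.mem_piFinset.2 fun u => ?_
    by_cases hu : u = v
    · subst hu; simpa [targets] using hw
    · simp [hu, targets]
  · intro w hw
    have hwv : w ≠ v := by
      simp only [others, Finset.mem_filter] at hw
      exact hw.2.1
    have hnone : ∀ u, u ≠ v →
        (Function.update (fun _ => none) v (some w) : Voter K M → Option (Voter K M)) u = none := by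
      intro u hu
      simp [hu]
    have hflow : ∀ x u, x ≠ v → (Flows (Function.update (fun _ => none) v (some w)) x u ↔
        u = x) := by
      intro x u hx
      constructor
      · intro h
        rcases Relation.ReflTransGen.cases_head h with h | ⟨c, hc, -⟩
        · exact h.symm
        · rw [hnone x hx] at hc
          cases hc
      · rintro rfl
        exact Relation.ReflTransGen.refl
    have hflow' : ∀ u, u ≠ v → (Flows (Function.update (fun _ => none) v (some w)) v u ↔
        u = w) := by
      intro u hu
      constructor
      · intro h
        rcases Relation.ReflTransGen.cases_head h with h | ⟨c, hc, h⟩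
        · exact absurd h.symm hu
        · simp only [Function.update_self, Option.some.injEq] at hc
          subst hc
          exact (hflow _ u hwv).1 h
      · rintro rfl
        exact Relation.ReflTransGen.single (by simp)
    rw [resolvedWinProb_of_not_trapped]
    · symm
      refine winProb_of_destination _ _ (fun x => if x = v then w else x) ?_ _ ?_ d
      · intro x u d' hu
        have huv : u ≠ v := by
          rintro rfl
          simp at hu
        by_cases hx : x = v
        · subst hx
          simpa using hflow' u huv
        · simpa [hx] using hflow x u hx
      · intro x
        by_cases hx : x = v
        · subst hx; simp [hwv]
        · simp [hx]
    · intro x hx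
      by_cases hxv : x = v
      · subst hxv
        exact hx w ((hflow' w hwv).2 rfl) (hnone w hwv)
      · exact hx x Relation.ReflTransGen.refl (hnone x hxv)
  · intro w _ w' _ h
    have := congrFun h v
    simpa using this
  · intro t ht
    simp only [Finset.mem_coe, draws, Fintype.mem_piFinset] at ht
    have hv := ht v
    simp only [Function.update_self, targets, Finset.mem_map, Function.Embedding.some_apply] at hv
    obtain ⟨w, hw, hwt⟩ := hv
    refine ⟨w, hw, ?_⟩
    funext u
    by_cases hu : u = v
    · subst hu; simpa using hwt
    · have := ht u
      simp only [hu, Function.update_of_ne, ne_eq, not_false_eq_true, targets,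
        Finset.mem_singleton] at this
      simp [hu, this]

/-! ### The reduced game -/

/-- The probability of decision `ω` when the voters act independently and `z v x` is the
probability of action `x` for voter `v`. It is a multilinear function of the vectors `z v`. -/
noncomputable def payoff (ω : Bool) :
    MultilinearMap ℝ (fun _ : Voter K M => Action → ℝ) ℝ :=
  ∑ a : Voter K M → Action, decisionProb a ω •
    (MultilinearMap.mkPiAlgebra ℝ (Voter K M) ℝ).compLinearMap fun v => LinearMap.proj (a v)

lemma payoff_apply (ω : Bool) (z : Voter K M → Action → ℝ) :
    payoff ω z = ∑ a : Voter K M → Action, (∏ v, z v (a v)) * decisionProb a ω := by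
  simp [payoff, mul_comm]

/-- Interchanging the two states and the two decisions changes nothing. -/
lemma payoff_flip (ω : Bool) (z : Voter K M → Action → ℝ) :
    payoff (!ω) (fun v x => z v (flipAction x)) = payoff ω z := by
  rw [payoff_apply, payoff_apply]
  refine Fintype.sum_equiv (Equiv.arrowCongr (Equiv.refl _) flipEquiv) _ _ fun a => ?_
  have h := decisionProb_flip (fun v => flipAction (a v)) ω
  simp only [flipAction_flipAction] at h
  rw [h]
  rfl

/-- The members of a category are interchangeable. -/
lemma payoff_relabel (ω : Bool) {e : Equiv.Perm (Voter K M)} (he : ∀ v, kind (e v) = kind v)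
    (z : Voter K M → Action → ℝ) : payoff ω (fun v => z (e v)) = payoff ω z := by
  rw [payoff_apply, payoff_apply]
  refine Fintype.sum_equiv (Equiv.arrowCongr e (Equiv.refl _)) _ _ fun a => ?_
  have h : (Equiv.arrowCongr e (Equiv.refl _)) a = a ∘ e.symm := rfl
  rw [h, decisionProb_relabel he]
  congr 1
  refine Fintype.prod_equiv e _ _ fun v => ?_
  simp

/-- Only available actions have positive probability. -/
def Supported (v : Voter K M) (y : Action → ℝ) : Prop := ∀ x, ¬ Available v x → y x = 0

lemma payoff_add {z : Voter K M → Action → ℝ} (hz : ∀ v, Supported v (z v)) :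
    payoff true z + payoff false z = ∏ v, ∑ x, z v x := by
  rw [payoff_apply, payoff_apply, ← Finset.sum_add_distrib, Fintype.prod_sum]
  refine Finset.sum_congr rfl fun a _ => ?_
  rw [← mul_add]
  by_cases ha : ∀ v, Available v (a v)
  · rw [decisionProb_add ha, mul_one]
  · push Not at ha
    obtain ⟨v, hv⟩ := ha
    rw [Finset.prod_eq_zero (Finset.mem_univ v) (hz v _ hv), zero_mul]

lemma payoff_update (ω : Bool) (z : Voter K M → Action → ℝ) (v : Voter K M) (y : Action → ℝ) :
    payoff ω (Function.update z v y) =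
      ∑ x, y x * payoff ω (Function.update z v (Pi.single x 1)) := by
  have hy : y = ∑ x, y x • (Pi.single x 1 : Action → ℝ) := by
    funext x
    simp [Finset.sum_apply, Pi.single_apply]
  conv_lhs => rw [hy]
  rw [MultilinearMap.map_update_sum]
  refine Finset.sum_congr rfl fun x _ => ?_
  rw [MultilinearMap.map_update_smul, smul_eq_mul]

/-- Conditioning on the actions of the voters other than `v`: the choice of the reference
action `y` is immaterial. -/
lemma payoff_update_single (ω : Bool) (z : Voter K M → Action → ℝ) (v : Voter K M)
    (x y : Action) :
    payoff ω (Function.update z v (Pi.single x 1)) =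
      ∑ a : Voter K M → Action, (∏ w, Function.update z v (Pi.single y 1) w (a w)) *
        decisionProb (Function.update a v x) ω := by
  rw [payoff_apply]
  symm
  refine Fintype.sum_equiv
    (Equiv.piCongrRight fun w => if w = v then Equiv.swap x y else Equiv.refl _) _ _ fun a => ?_
  set a' := (Equiv.piCongrRight fun w => if w = v then Equiv.swap x y else Equiv.refl _) a with ha'
  have h1 : ∀ w, w ≠ v → a' w = a w := by
    intro w hw
    simp [ha', hw]
  have h2 : a' v = Equiv.swap x y (a v) := by
    simp [ha']
  by_cases hy : a v = y
  · have : Function.update a v x = a' := by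
      funext w
      by_cases hw : w = v
      · subst hw; simp [h2, hy]
      · simp [hw, h1 w hw]
    rw [this]
    congr 1
    refine Finset.prod_congr rfl fun w _ => ?_
    by_cases hw : w = v
    · subst hw; simp [h2, hy]
    · simp [hw, h1 w hw]
  · rw [Finset.prod_eq_zero (Finset.mem_univ v), Finset.prod_eq_zero (Finset.mem_univ v)]
    · simp
    · rw [h2, Function.update_self, Pi.single_eq_of_ne]
      intro h
      exact hy ((Equiv.swap x y).injective (h.trans (Equiv.swap_apply_right x y).symm))
    · rw [Function.update_self, Pi.single_eq_of_ne hy]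

lemma payoff_vote_mono (ω : Bool) {z : Voter K M → Action → ℝ} (v : Voter K M)
    (hz : ∀ w ≠ v, ∀ x, 0 ≤ z w x) :
    payoff ω (Function.update z v (Pi.single (.vote !ω) 1)) ≤
      payoff ω (Function.update z v (Pi.single (.vote ω) 1)) := by
  rw [payoff_update_single ω z v _ (.vote true), payoff_update_single ω z v (.vote ω) (.vote true)]
  refine Finset.sum_le_sum fun a _ => mul_le_mul_of_nonneg_left (decisionProb_update_mono a v ω) ?_
  refine Finset.prod_nonneg fun w _ => ?_
  by_cases hw : w = v
  · subst hw
    rw [Function.update_self]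
    by_cases h : a w = .vote true
    · simp [h]
    · simp [Pi.single_eq_of_ne h]
  · simpa [hw] using hz w hw _

/-- Improvements that hold for one voter at a time can be made for all voters together. -/
lemma payoff_le_of_forall_update (ω : Bool) {z z' : Voter K M → Action → ℝ}
    (h : ∀ v (u : Voter K M → Action → ℝ), (∀ w, u w = z w ∨ u w = z' w) →
      payoff ω (Function.update u v (z v)) ≤ payoff ω (Function.update u v (z' v))) :
    payoff ω z ≤ payoff ω z' := by
  classical
  have key : ∀ S : Finset (Voter K M),
      payoff ω z ≤ payoff ω (fun w => if w ∈ S then z' w else z w) := by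
    intro S
    induction S using Finset.induction_on with
    | empty => simp
    | insert v S hv ih =>
      refine ih.trans ?_
      have := h v (fun w => if w ∈ S then z' w else z w) fun w => by
        by_cases hw : w ∈ S <;> simp [hw]
      have e1 : Function.update (fun w => if w ∈ S then z' w else z w) v (z v) =
          fun w => if w ∈ S then z' w else z w := by
        refine Function.update_eq_self_iff.2 ?_
        simp [hv]
      have e2 : Function.update (fun w => if w ∈ S then z' w else z w) v (z' v) =
          fun w => if w ∈ insert v S then z' w else z w := by
        funext w
        by_cases hw : w = v
        · subst hw; simp
        · simp [hw]
      rwa [e1, e2] at this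
  simpa using key Finset.univ

/-! ### One voter among voters who all vote -/

/-- The number of voters other than `v` who vote for `d`. -/
def countOthers (τ : Voter K M → Bool) (v : Voter K M) (d : Bool) : ℕ :=
  ((Finset.univ.erase v).filter fun w => τ w = d).card

lemma countOthers_add (τ : Voter K M → Bool) (v : Voter K M) :
    countOthers τ v true + countOthers τ v false + 1 = K + M := by
  have h := Finset.card_filter_add_card_filter_not (s := Finset.univ.erase v)
    (fun w => τ w = true)
  have h2 : (Finset.univ.erase v).card + 1 = K + M := by
    rw [Finset.card_erase_add_one (Finset.mem_univ v)]
    simp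
  simp only [Bool.not_eq_true] at h
  unfold countOthers
  omega

lemma card_update_eq (τ : Voter K M → Bool) (v : Voter K M) (d d' : Bool) :
    (Finset.univ.filter fun w => Function.update τ v d w = d').card =
      countOthers τ v d' + if d = d' then 1 else 0 := by
  rw [← Finset.insert_erase (Finset.mem_univ v), Finset.filter_insert]
  have h : ((Finset.univ.erase v).filter fun w => Function.update τ v d w = d') =
      (Finset.univ.erase v).filter fun w => τ w = d' := by
    refine Finset.filter_congr fun w hw => ?_
    rw [Function.update_of_ne (Finset.ne_of_mem_erase hw)]
  rw [h]
  unfold countOthers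
  simp only [Function.update_self]
  split_ifs
  · rw [Finset.card_insert_of_notMem (by simp)]
  · rfl

/-- The effect of the vote of `v` on the decision, when the others vote according to `τ`. -/
noncomputable def pivot (τ : Voter K M → Bool) (v : Voter K M) : ℝ :=
  if countOthers τ v true = countOthers τ v false then 1 else 0

lemma majority_update_sub (hN : Odd (K + M)) (τ : Voter K M → Bool) (v : Voter K M) :
    majority (Function.update τ v true) true - majority (Function.update τ v false) true =
      pivot τ v := by
  have h := countOthers_add τ v
  obtain ⟨m, hm⟩ := hN
  simp only [majority, pivot, card_update_eq]
  simp only [Bool.not_true, Bool.true_eq_false, Bool.false_eq_true, if_false, if_true]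
  split_ifs <;> first | omega | norm_num

/-- The sign of a vote, as a number. -/
def sign (d : Bool) : ℝ := if d then 1 else -1

lemma sum_sign_of_pivot (τ : Voter K M → Bool) (v : Voter K M) :
    pivot τ v * ∑ w ∈ Finset.univ.erase v, sign (τ w) = 0 := by
  unfold pivot
  split_ifs with h
  · rw [one_mul, ← Finset.sum_filter_add_sum_filter_not _ (fun w => τ w = true)]
    have h1 : ∀ d, ∑ w ∈ (Finset.univ.erase v).filter (fun w => τ w = d), sign (τ w) =
        countOthers τ v d * sign d := by
      intro d
      rw [Finset.sum_congr rfl (g := fun _ => sign d), Finset.sum_const, nsmul_eq_mul]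
      · rfl
      · intro w hw
        rw [(Finset.mem_filter.1 hw).2]
    simp only [Bool.not_eq_true]
    rw [h1, h1, h]
    simp [sign]
  · simp

/-- Some votes make `v` pivotal while `e` is right and `u` is wrong. -/
lemma exists_pivot (hN : Odd (K + M)) {v e u : Voter K M} (hev : e ≠ v) (huv : u ≠ v)
    (heu : e ≠ u) : ∃ τ : Voter K M → Bool,
      τ v = true ∧ τ e = true ∧ τ u = false ∧ pivot τ v = 1 := by
  classical
  obtain ⟨m, hm⟩ := hN
  set S := ((Finset.univ.erase v).erase e).erase u with hS
  have hcard : S.card + 2 = 2 * m := by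
    have h1 : (Finset.univ.erase v).card + 1 = K + M := by
      rw [Finset.card_erase_add_one (Finset.mem_univ v)]
      simp
    have h2 := Finset.card_erase_add_one (s := Finset.univ.erase v) (a := e) (by simp [hev])
    have h3 : S.card + 1 = _ :=
      Finset.card_erase_add_one (s := (Finset.univ.erase v).erase e) (a := u)
        (by simp [huv, heu.symm])
    omega
  obtain ⟨T, hTS, hT⟩ := Finset.exists_subset_card_eq (s := S) (n := m - 1) (by omega)
  have hT' : ∀ w ∈ T, w ≠ u ∧ w ≠ e ∧ w ≠ v := by
    intro w hw
    simpa [hS] using hTS hw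
  refine ⟨fun w => decide (w = v ∨ w = e ∨ w ∈ T), by simp, by simp, ?_, ?_⟩
  · simp only [decide_eq_false_iff_not, not_or]
    exact ⟨huv, heu.symm, fun h => (hT' u h).1 rfl⟩
  · have hadd := countOthers_add (fun w => decide (w = v ∨ w = e ∨ w ∈ T)) v
    have htrue : countOthers (fun w => decide (w = v ∨ w = e ∨ w ∈ T)) v true = m := by
      unfold countOthers
      have : ((Finset.univ.erase v).filter fun w => decide (w = v ∨ w = e ∨ w ∈ T) = true) =
          insert e T := by
        ext w
        simp only [decide_eq_true_eq, Finset.mem_filter, Finset.mem_erase, Finset.mem_univ,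
          and_true, Finset.mem_insert]
        constructor
        · rintro ⟨h1, h2⟩
          tauto
        · rintro (rfl | h)
          · exact ⟨hev, Or.inr (Or.inl rfl)⟩
          · exact ⟨(hT' w h).2.2, Or.inr (Or.inr h)⟩
      rw [this, Finset.card_insert_of_notMem (fun h => (hT' e h).2.1 rfl), hT]
      omega
    unfold pivot
    rw [if_pos (by omega)]

/-- The action probabilities, in the state `true`, of a voter who votes and is right with
probability `r`. -/
def sincereVector (r : ℝ) : Action → ℝ
  | .vote d => if d then r else 1 - r
  | .delegate _ => 0

lemma sum_eq_sum_vote {z : Voter K M → Action → ℝ} (f : (Voter K M → Action) → ℝ)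
    (hz : ∀ v k, z v (.delegate k) = 0) :
    ∑ a : Voter K M → Action, (∏ v, z v (a v)) * f a =
      ∑ τ : Voter K M → Bool, (∏ v, z v (.vote (τ v))) * f fun v => .vote (τ v) := by
  symm
  refine Finset.sum_of_injOn (fun τ v => Action.vote (τ v)) ?_ ?_ ?_ ?_
  · intro τ _ τ' _ h
    funext v
    simpa using congrFun h v
  · intro τ _
    simp
  · intro a _ ha
    suffices h : ∃ v k, a v = .delegate k by
      obtain ⟨v, k, h⟩ := h
      rw [Finset.prod_eq_zero (Finset.mem_univ v) (by rw [h]; exact hz v k), zero_mul]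
    by_contra! h
    apply ha
    have : ∀ v, ∃ d, a v = .vote d := by
      intro v
      cases hv : a v with
      | vote d => exact ⟨d, rfl⟩
      | delegate k => exact absurd hv (h v k)
    choose τ hτ using this
    exact ⟨τ, by simp, by funext v; exact (hτ v).symm⟩
  · intro τ _
    rfl

/-- The probability of the votes `τ` of the voters other than `v`; the entry `τ v` is fixed to
be `true`. -/
noncomputable def othersProb (r : Voter K M → ℝ) (v : Voter K M) (τ : Voter K M → Bool) : ℝ :=
  if τ v then ∏ w ∈ Finset.univ.erase v, if τ w then r w else 1 - r w else 0

lemma payoff_sincere_update (r : Voter K M → ℝ) (v : Voter K M) (x : Action) :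
    payoff true (Function.update (fun w => sincereVector (r w)) v (Pi.single x 1)) =
      ∑ τ : Voter K M → Bool, othersProb r v τ *
        decisionProb (Function.update (fun w => .vote (τ w)) v x) true := by
  rw [payoff_update_single true _ v x (.vote true)]
  have := sum_eq_sum_vote
    (z := Function.update (fun w => sincereVector (r w)) v (Pi.single (.vote true) 1))
    (fun a => decisionProb (Function.update a v x) true) (by
      intro w k
      by_cases hw : w = v
      · subst hw; simp
      · simp [hw, sincereVector])
  rw [this]
  refine Finset.sum_congr rfl fun τ _ => ?_
  congr 1
  rw [← Finset.mul_prod_erase _ _ (Finset.mem_univ v), Function.update_self]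
  unfold othersProb
  split_ifs with h
  · rw [h, Pi.single_eq_same, one_mul]
    refine Finset.prod_congr rfl fun w hw => ?_
    rw [Function.update_of_ne (Finset.ne_of_mem_erase hw)]
    rfl
  · rw [Pi.single_eq_of_ne (by simpa using h), zero_mul]

lemma payoff_sincere_update_vote (r : Voter K M → ℝ) (v : Voter K M) (d : Bool) :
    payoff true (Function.update (fun w => sincereVector (r w)) v (Pi.single (.vote d) 1)) =
      ∑ τ : Voter K M → Bool, othersProb r v τ * majority (Function.update τ v d) true := by
  rw [payoff_sincere_update]
  refine Finset.sum_congr rfl fun τ _ => ?_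
  rw [← decisionProb_vote]
  congr 2
  funext w
  by_cases hw : w = v
  · subst hw; simp
  · simp [hw]

lemma payoff_sincere_update_delegate (r : Voter K M → ℝ) (v : Voter K M) (k : Kind) :
    payoff true (Function.update (fun w => sincereVector (r w)) v (Pi.single (.delegate k) 1)) =
      ∑ τ : Voter K M → Bool, othersProb r v τ *
        (others v k).expect fun w => majority (Function.update τ v (τ w)) true := by
  rw [payoff_sincere_update]
  refine Finset.sum_congr rfl fun τ _ => ?_
  rw [decisionProb_update_delegate]

section Pivot

variable (r : Voter K M → ℝ)

lemma othersProb_nonneg (h0 : ∀ w, 0 < r w) (h1 : ∀ w, r w < 1) (v : Voter K M)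
    (τ : Voter K M → Bool) : 0 ≤ othersProb r v τ := by
  unfold othersProb
  split_ifs
  · refine Finset.prod_nonneg fun w _ => ?_
    split_ifs
    · exact (h0 w).le
    · linarith [h1 w]
  · rfl

lemma othersProb_pos (h0 : ∀ w, 0 < r w) (h1 : ∀ w, r w < 1) (v : Voter K M)
    (τ : Voter K M → Bool) (hτ : τ v = true) : 0 < othersProb r v τ := by
  unfold othersProb
  rw [if_pos hτ]
  refine Finset.prod_pos fun w _ => ?_
  split_ifs
  · exact h0 w
  · linarith [h1 w]

/-- Under sincere voting of all others, every voter is pivotal with positive probability. -/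
lemma payoff_sincere_vote_lt (hN : Odd (K + M)) (h0 : ∀ w, 0 < r w) (h1 : ∀ w, r w < 1)
    {v e u : Voter K M} (hev : e ≠ v) (huv : u ≠ v) (heu : e ≠ u) :
    payoff true (Function.update (fun w => sincereVector (r w)) v (Pi.single (.vote false) 1)) <
      payoff true
        (Function.update (fun w => sincereVector (r w)) v (Pi.single (.vote true) 1)) := by
  rw [payoff_sincere_update_vote, payoff_sincere_update_vote, ← sub_pos, ← Finset.sum_sub_distrib]
  obtain ⟨τ, hv, -, -, hp⟩ := exists_pivot hN hev huv heu
  refine Finset.sum_pos' (fun τ _ => ?_) ⟨τ, Finset.mem_univ _, ?_⟩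
  · rw [← mul_sub, majority_update_sub hN]
    refine mul_nonneg (othersProb_nonneg r h0 h1 v τ) ?_
    unfold pivot
    split_ifs <;> norm_num
  · rw [← mul_sub, majority_update_sub hN, hp, mul_one]
    exact othersProb_pos r h0 h1 v τ hv

/-- When `v` is pivotal, the vote of the better informed voter `e` is the better one: exchanging
the votes of `e` and `u` leaves `v` pivotal, and the votes are more likely to be those in which `e`
is right. -/
lemma sum_othersProb_sign_lt (hN : Odd (K + M)) (h0 : ∀ w, 0 < r w) (h1 : ∀ w, r w < 1)
    {v e u : Voter K M} (hev : e ≠ v) (huv : u ≠ v) (heu : e ≠ u) (hr : r u < r e) :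
    ∑ τ : Voter K M → Bool, othersProb r v τ * (pivot τ v * sign (τ u)) <
      ∑ τ : Voter K M → Bool, othersProb r v τ * (pivot τ v * sign (τ e)) := by
  classical
  set s := Equiv.swap e u with hs
  have hsv : s v = v := Equiv.swap_apply_of_ne_of_ne hev.symm huv.symm
  have hpiv : ∀ τ : Voter K M → Bool, pivot (τ ∘ s) v = pivot τ v := by
    intro τ
    have : ∀ d, countOthers (τ ∘ s) v d = countOthers τ v d := by
      intro d
      refine Finset.card_equiv s fun w => ?_
      simp only [Finset.mem_filter, Finset.mem_erase, Finset.mem_univ, Function.comp_apply,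
        and_true]
      refine and_congr_left fun _ => not_congr ?_
      conv_rhs => rw [← hsv]
      exact (Equiv.apply_eq_iff_eq s).symm
    unfold pivot
    rw [this, this]
  let f : Equiv.Perm (Voter K M → Bool) := Equiv.arrowCongr s.symm (Equiv.refl _)
  have hf : ∀ τ, f τ = τ ∘ s := fun τ => rfl
  have hE : ∑ τ : Voter K M → Bool, othersProb r v τ * (pivot τ v * sign (τ e)) =
      ∑ τ : Voter K M → Bool, othersProb r v (τ ∘ s) * (pivot τ v * sign (τ u)) := by
    symm
    refine Fintype.sum_equiv f _ _ fun τ => ?_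
    rw [hf, hpiv]
    simp [hs]
  have hU : ∑ τ : Voter K M → Bool, othersProb r v τ * (pivot τ v * sign (τ u)) =
      ∑ τ : Voter K M → Bool, othersProb r v (τ ∘ s) * (pivot τ v * sign (τ e)) := by
    symm
    refine Fintype.sum_equiv f _ _ fun τ => ?_
    rw [hf, hpiv]
    simp [hs]
  have hprod : ∀ τ : Voter K M → Bool, τ v = true → ∃ R : ℝ, 0 < R ∧
      othersProb r v τ = R * ((if τ e then r e else 1 - r e) * (if τ u then r u else 1 - r u)) ∧
      othersProb r v (τ ∘ s) =
        R * ((if τ u then r e else 1 - r e) * (if τ e then r u else 1 - r u)) := by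
    intro τ hτ
    refine ⟨∏ w ∈ ((Finset.univ.erase v).erase e).erase u, if τ w then r w else 1 - r w,
      Finset.prod_pos fun w _ => ?_, ?_, ?_⟩
    · split_ifs
      · exact h0 w
      · linarith [h1 w]
    · unfold othersProb
      rw [if_pos hτ, ← Finset.mul_prod_erase _ _ (show e ∈ Finset.univ.erase v by simp [hev]),
        ← Finset.mul_prod_erase _ _
          (show u ∈ (Finset.univ.erase v).erase e by simp [huv, heu.symm])]
      ring
    · unfold othersProb
      rw [if_pos (by simp [hsv, hτ]),
        ← Finset.mul_prod_erase _ _ (show e ∈ Finset.univ.erase v by simp [hev]),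
        ← Finset.mul_prod_erase _ _
          (show u ∈ (Finset.univ.erase v).erase e by simp [huv, heu.symm])]
      have : ∏ w ∈ ((Finset.univ.erase v).erase e).erase u,
          (if (τ ∘ s) w then r w else 1 - r w) =
          ∏ w ∈ ((Finset.univ.erase v).erase e).erase u, if τ w then r w else 1 - r w := by
        refine Finset.prod_congr rfl fun w hw => ?_
        simp only [Finset.mem_erase] at hw
        rw [Function.comp_apply, hs, Equiv.swap_apply_of_ne_of_ne hw.2.1 hw.1]
      rw [this]
      simp only [Function.comp_apply, hs, Equiv.swap_apply_left, Equiv.swap_apply_right]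
      ring
  have h2 : 0 < ∑ τ : Voter K M → Bool, (othersProb r v τ - othersProb r v (τ ∘ s)) *
      (pivot τ v * (sign (τ e) - sign (τ u))) := by
    obtain ⟨τ₀, hv, he, hu, hp⟩ := exists_pivot hN hev huv heu
    refine Finset.sum_pos' (fun τ _ => ?_) ⟨τ₀, Finset.mem_univ _, ?_⟩
    · by_cases hτ : τ v = true
      · obtain ⟨R, hR, e1, e2⟩ := hprod τ hτ
        have hp0 : 0 ≤ pivot τ v := by
          unfold pivot
          split_ifs <;> norm_num
        rw [e1, e2, mul_left_comm]
        refine mul_nonneg hp0 ?_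
        cases τ e <;> cases τ u <;> simp only [sign] <;> norm_num <;> nlinarith
      · have : othersProb r v τ = 0 := by simp [othersProb, hτ]
        have h' : othersProb r v (τ ∘ s) = 0 := by simp [othersProb, hsv, hτ]
        simp [this, h']
    · obtain ⟨R, hR, e1, e2⟩ := hprod τ₀ hv
      rw [e1, e2, hp, he, hu]
      simp only [sign]
      norm_num
      nlinarith
  have h3 : ∑ τ : Voter K M → Bool, (othersProb r v τ - othersProb r v (τ ∘ s)) *
      (pivot τ v * (sign (τ e) - sign (τ u))) =
      2 * (∑ τ : Voter K M → Bool, othersProb r v τ * (pivot τ v * sign (τ e)) -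
        ∑ τ : Voter K M → Bool, othersProb r v τ * (pivot τ v * sign (τ u))) := by
    rw [two_mul]
    conv_rhs =>
      arg 2
      rw [hE, hU]
    simp only [← Finset.sum_sub_distrib, ← Finset.sum_add_distrib]
    refine Finset.sum_congr rfl fun τ _ => ?_
    ring
  rw [h3] at h2
  linarith

end Pivot

lemma kind_eq_nonExpert {v : Voter K M} : kind v = .nonExpert ↔ ¬ kind v = .expert := by
  cases kind v <;> simp

/-- Copying the vote of a random expert is better than adding an uninformative vote. When `v` is
pivotal the votes of the others are split evenly, so that the right votes of experts and of
non-experts must balance; and each expert is then more likely to be right than each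
non-expert. -/
lemma payoff_sincere_delegate_gt (hN : Odd (K + M)) {r : Voter K M → ℝ} (h0 : ∀ w, 0 < r w)
    (h1 : ∀ w, r w < 1) (hr : ∀ e u, kind e = .expert → kind u = .nonExpert → r u < r e)
    {v : Voter K M} (he : (others v .expert).Nonempty)
    (hn : (others v .nonExpert).Nonempty) :
    (payoff true (Function.update (fun w => sincereVector (r w)) v (Pi.single (.vote true) 1)) +
      payoff true (Function.update (fun w => sincereVector (r w)) v
        (Pi.single (.vote false) 1))) / 2 <
      payoff true (Function.update (fun w => sincereVector (r w)) v
        (Pi.single (.delegate .expert) 1)) := by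
  classical
  set E : Voter K M → ℝ := fun w => ∑ τ : Voter K M → Bool,
    othersProb r v τ * (pivot τ v * sign (τ w)) with hE
  have hlt : ∀ e ∈ others v .expert, ∀ u ∈ others v .nonExpert, E u < E e := by
    intro e he u hu
    simp only [others, Finset.mem_filter, Finset.mem_univ, true_and] at he hu
    refine sum_othersProb_sign_lt r hN h0 h1 he.1 hu.1 ?_ (hr e u he.2 hu.2)
    rintro rfl
    rw [he.2] at hu
    exact absurd hu.2 (by decide)
  have hsum : ∑ e ∈ others v .expert, E e + ∑ u ∈ others v .nonExpert, E u = 0 := by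
    have h2 : ∑ w ∈ Finset.univ.erase v, E w = 0 := by
      rw [hE, Finset.sum_comm]
      refine Finset.sum_eq_zero fun τ _ => ?_
      rw [← Finset.mul_sum, ← Finset.mul_sum, sum_sign_of_pivot, mul_zero]
    rw [← Finset.sum_filter_add_sum_filter_not _ (fun w => kind w = .expert)] at h2
    convert h2 using 3
    · ext w; simp [others]
    · ext w; simp [others, kind_eq_nonExpert]
  have hpos : 0 < ∑ e ∈ others v .expert, E e := by
    by_contra! hle
    obtain ⟨e, hee, hEe⟩ : ∃ e ∈ others v .expert, E e ≤ 0 := by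
      by_contra! h
      exact absurd (Finset.sum_pos h he) (not_lt.2 hle)
    have : ∑ u ∈ others v .nonExpert, E u < 0 :=
      Finset.sum_neg (fun u hu => (hlt e hee u hu).trans_le hEe) hn
    linarith
  have hkey : payoff true (Function.update (fun w => sincereVector (r w)) v
        (Pi.single (.delegate .expert) 1)) -
      (payoff true (Function.update (fun w => sincereVector (r w)) v (Pi.single (.vote true) 1)) +
      payoff true (Function.update (fun w => sincereVector (r w)) v
        (Pi.single (.vote false) 1))) / 2 =
      (others v .expert).expect fun w => E w / 2 := by
    rw [payoff_sincere_update_vote, payoff_sincere_update_vote, payoff_sincere_update_delegate,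
      ← Finset.sum_add_distrib, Finset.sum_div, ← Finset.sum_sub_distrib]
    simp only [hE, Finset.sum_div]
    rw [Finset.expect_sum_comm]
    refine Finset.sum_congr rfl fun τ _ => ?_
    rw [← mul_add, mul_div_assoc, ← mul_sub]
    simp only [mul_div_assoc, ← Finset.mul_expect]
    congr 1
    rw [← Finset.expect_const he ((majority (Function.update τ v true) true +
      majority (Function.update τ v false) true) / 2), ← Finset.expect_sub_distrib,
      Finset.mul_expect]
    refine Finset.expect_congr rfl fun w _ => ?_
    rw [← majority_update_sub hN]
    cases τ w <;> simp [sign] <;> ring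
  rw [← sub_pos, hkey, ← Finset.expect_div, Finset.expect_eq_sum_div_card]
  have := he.card_pos
  positivity

/-! ### Integrating out the precisions -/

/-- The standing assumptions on the electorate and the precisions. -/
structure Setting (K M : ℕ) (p : ℝ) (F : Measure ℝ) : Prop where
  odd_total : Odd (K + M)
  odd_experts : Odd K
  pos_nonExperts : 0 < M
  half_lt : 1 / 2 < p
  lt_one : p < 1
  noAtoms : ∀ x, F {x} = 0
  support : F.support = Set.Icc (1 / 2) p

instance (p : ℝ) (F : Measure ℝ) [IsProbabilityMeasure F] (k : Kind) :
    IsProbabilityMeasure (precisionLaw p F k) := by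
  cases k
  · exact inferInstanceAs (IsProbabilityMeasure (Measure.dirac p))
  · assumption

lemma Setting.ae_mem {p : ℝ} {F : Measure ℝ} (h : Setting K M p F) (k : Kind) :
    ∀ᵐ q ∂precisionLaw p F k, q ∈ Set.Icc (1 / 2) p := by
  cases k
  · change ∀ᵐ q ∂Measure.dirac p, q ∈ Set.Icc (1 / 2) p
    exact (ae_dirac_iff measurableSet_Icc).2 ⟨h.half_lt.le, le_rfl⟩
  · rw [← h.support]
    exact Measure.support_mem_ae

lemma signalProb_not (q : ℝ) (ω σ : Bool) : signalProb q (!ω) (!σ) = signalProb q ω σ := by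
  cases ω <;> cases σ <;> rfl

lemma sum_signalProb (q : ℝ) (ω : Bool) : ∑ σ, signalProb q ω σ = 1 := by
  cases ω <;> simp [signalProb]

lemma Setting.signalProb_nonneg {p : ℝ} {F : Measure ℝ} (h : Setting K M p F) {q : ℝ}
    (hq : q ∈ Set.Icc (1 / 2) p) (ω σ : Bool) : 0 ≤ signalProb q ω σ := by
  have := h.lt_one
  unfold signalProb
  split_ifs <;> linarith [hq.1, hq.2]

lemma measurable_signalProb (ω σ : Bool) : Measurable fun q => signalProb q ω σ := by
  unfold signalProb
  split_ifs <;> fun_prop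

/-- Action probabilities as functions of precision and signal. -/
structure IsBehaviour (f : ℝ → Bool → Action → ℝ) : Prop where
  nonneg : ∀ q σ x, 0 ≤ f q σ x
  sum_eq_one : ∀ q σ, ∑ x, f q σ x = 1
  measurable : ∀ σ x, Measurable fun q => f q σ x

lemma IsBehaviour.le_one {f : ℝ → Bool → Action → ℝ} (h : IsBehaviour f) (q : ℝ) (σ : Bool)
    (x : Action) : f q σ x ≤ 1 := by
  rw [← h.sum_eq_one q σ]
  exact Finset.single_le_sum (fun y _ => h.nonneg q σ y) (Finset.mem_univ x)

lemma Strategy.isBehaviour {v : Voter K M} (s : Strategy v) : IsBehaviour s.prob :=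
  ⟨s.nonneg, s.sum_eq_one, s.measurable⟩

/-- The probability of each action in state `ω`, for a voter with precision distributed as `ν`
and behaviour `f`. -/
noncomputable def moments (ν : Measure ℝ) (ω : Bool) (f : ℝ → Bool → Action → ℝ)
    (x : Action) : ℝ :=
  ∫ q, ∑ σ, signalProb q ω σ * f q σ x ∂ν

section Moments

variable {p : ℝ} {F : Measure ℝ} [IsProbabilityMeasure F]

lemma Setting.integrable_of_bounded (h : Setting K M p F) (k : Kind) {g : ℝ → ℝ}
    (hg : Measurable g) (C : ℝ) (hC : ∀ q ∈ Set.Icc (1 / 2) p, |g q| ≤ C) :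
    Integrable g (precisionLaw p F k) :=
  Integrable.of_bound hg.aestronglyMeasurable C <| by
    filter_upwards [h.ae_mem k] with q hq
    exact hC q hq

lemma Setting.integrable_moments (h : Setting K M p F) (k : Kind) (ω : Bool)
    {f : ℝ → Bool → Action → ℝ} (hf : IsBehaviour f) (x : Action) :
    Integrable (fun q => ∑ σ, signalProb q ω σ * f q σ x) (precisionLaw p F k) := by
  refine h.integrable_of_bounded k ?_ 1 fun q hq => ?_
  · exact Finset.measurable_sum _ fun σ _ => (measurable_signalProb ω σ).mul (hf.measurable σ x)
  · rw [abs_of_nonneg (Finset.sum_nonneg fun σ _ =>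
      mul_nonneg (h.signalProb_nonneg hq ω σ) (hf.nonneg q σ x)), ← sum_signalProb q ω]
    exact Finset.sum_le_sum fun σ _ => mul_le_of_le_one_right (h.signalProb_nonneg hq ω σ)
      (hf.le_one q σ x)

lemma Setting.sum_moments (h : Setting K M p F) (k : Kind) (ω : Bool)
    {f : ℝ → Bool → Action → ℝ} (hf : IsBehaviour f) :
    ∑ x, moments (precisionLaw p F k) ω f x = 1 := by
  unfold moments
  rw [← integral_finsetSum _ fun x _ => h.integrable_moments k ω hf x]
  have : ∀ q, ∑ x, ∑ σ, signalProb q ω σ * f q σ x = 1 := by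
    intro q
    rw [Finset.sum_comm]
    simp only [← Finset.mul_sum, hf.sum_eq_one, mul_one, sum_signalProb]
  simp only [this]
  simp

/-- Since precisions and, given the state, signals are independent across voters, the value in a
state depends on the strategies through the action probabilities in that state only. -/
lemma Setting.stateValue_eq (h : Setting K M p F) {b : Voter K M → ℝ → Bool → Action → ℝ}
    (hb : ∀ v, IsBehaviour (b v)) (ω : Bool) :
    stateValue p F b ω =
      payoff ω fun v => moments (precisionLaw p F (kind v)) ω (b v) := by
  have h1 : ∀ q : Voter K M → ℝ,
      ∑ σ : Voter K M → Bool, (∏ v, signalProb (q v) ω (σ v)) *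
        ∑ a : Voter K M → Action, (∏ v, b v (q v) (σ v) (a v)) * decisionProb a ω =
      ∑ a : Voter K M → Action,
        (∏ v, ∑ σ, signalProb (q v) ω σ * b v (q v) σ (a v)) * decisionProb a ω := by
    intro q
    simp only [Finset.mul_sum]
    rw [Finset.sum_comm]
    refine Finset.sum_congr rfl fun a _ => ?_
    rw [Fintype.prod_sum, Finset.sum_mul]
    refine Finset.sum_congr rfl fun σ _ => ?_
    rw [Finset.prod_mul_distrib, mul_assoc]
  unfold stateValue
  simp only [h1]
  rw [payoff_apply, integral_finsetSum]
  · refine Finset.sum_congr rfl fun a _ => ?_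
    rw [integral_mul_const]
    congr 1
    exact integral_fintype_prod_eq_prod (𝕜 := ℝ)
      (μ := fun v : Voter K M => precisionLaw p F (kind v))
      (f := fun v q => ∑ σ, signalProb q ω σ * b v q σ (a v))
  · intro a _
    refine Integrable.mul_const ?_ _
    exact Integrable.fintype_prod_dep (𝕜 := ℝ)
      (μ := fun v : Voter K M => precisionLaw p F (kind v))
      (f := fun v q => ∑ σ, signalProb q ω σ * b v q σ (a v))
      fun v => h.integrable_moments (kind v) ω (hb v) (a v)

lemma Setting.expectedUtility_eq (h : Setting K M p F) (s : Profile K M) :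
    expectedUtility (1 / 2) p F s =
      (payoff true (fun v => moments (precisionLaw p F (kind v)) true (s v).prob) +
        payoff false fun v => moments (precisionLaw p F (kind v)) false (s v).prob) / 2 := by
  unfold expectedUtility
  have : ∀ ω, stateValue p F (behaviour s) ω =
      payoff ω fun v => moments (precisionLaw p F (kind v)) ω (s v).prob :=
    fun ω => h.stateValue_eq (fun v => (s v).isBehaviour) ω
  simp only [this, Fintype.sum_bool, prior]
  norm_num
  ring

end Moments

/-- The behaviour in which recommendations of the signal and votes are both reversed. -/
def flipBehaviour (f : ℝ → Bool → Action → ℝ) : ℝ → Bool → Action → ℝ :=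
  fun q σ x => f q (!σ) (flipAction x)

lemma moments_flipBehaviour (ν : Measure ℝ) (ω : Bool) (f : ℝ → Bool → Action → ℝ) (x : Action) :
    moments ν (!ω) (flipBehaviour f) x = moments ν ω f (flipAction x) := by
  unfold moments flipBehaviour
  congr 1
  funext q
  rw [Fintype.sum_bool, Fintype.sum_bool]
  have h1 := signalProb_not q ω true
  have h2 := signalProb_not q ω false
  simp only [Bool.not_true, Bool.not_false] at h1 h2 ⊢
  rw [h1, h2]
  ring

/-- The action probabilities in the state `true`, averaged over a behaviour and its image under
the interchange of the two states. -/
noncomputable def averageMoments (ν : Measure ℝ) (f : ℝ → Bool → Action → ℝ) (x : Action) : ℝ :=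
  (moments ν true f x + moments ν false f (flipAction x)) / 2

/-! ### Symmetries of strategies and weak dominance -/

lemma available_flipAction (v : Voter K M) (x : Action) :
    Available v (flipAction x) ↔ Available v x := by
  cases x <;> simp [Available]

/-- The strategy in which recommendations of the signal and votes are both reversed. -/
def Strategy.flip {v : Voter K M} (s : Strategy v) : Strategy v where
  prob := flipBehaviour s.prob
  nonneg _ _ _ := s.nonneg _ _ _
  sum_eq_one q σ := (sum_flipAction (s.prob q (!σ))).trans (s.sum_eq_one q (!σ))
  available q σ x hx := s.available q _ _ (by rwa [available_flipAction])
  measurable σ x := s.measurable _ _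

/-- The strategy in which votes are reversed. -/
def Strategy.neg {v : Voter K M} (s : Strategy v) : Strategy v where
  prob q σ x := s.prob q σ (flipAction x)
  nonneg _ _ _ := s.nonneg _ _ _
  sum_eq_one q σ := (sum_flipAction (s.prob q σ)).trans (s.sum_eq_one q σ)
  available q σ x hx := s.available q _ _ (by rwa [available_flipAction])
  measurable σ x := s.measurable _ _

/-- The action probabilities in state `ω` under the profile `r`. -/
noncomputable def profileMoments (p : ℝ) (F : Measure ℝ) (r : Profile K M) (ω : Bool)
    (w : Voter K M) : Action → ℝ :=
  moments (precisionLaw p F (kind w)) ω (r w).prob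

lemma profileMoments_update (p : ℝ) (F : Measure ℝ) (r : Profile K M) (v : Voter K M)
    (s : Strategy v) (ω : Bool) :
    profileMoments p F (Function.update r v s) ω =
      Function.update (profileMoments p F r ω) v
        (moments (precisionLaw p F (kind v)) ω s.prob) := by
  funext w
  by_cases hw : w = v
  · subst hw
    simp [profileMoments]
  · simp [profileMoments, hw]

lemma supported_moments {v : Voter K M} (ν : Measure ℝ) (ω : Bool) (s : Strategy v) :
    Supported v (moments ν ω s.prob) := by
  intro x hx
  simp [moments, s.available _ _ x hx]

lemma profileMoments_flip (p : ℝ) (F : Measure ℝ) (r : Profile K M) (ω : Bool) (w : Voter K M)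
    (x : Action) :
    profileMoments p F (fun v => (r v).flip) ω w x =
      profileMoments p F r (!ω) w (flipAction x) := by
  have := moments_flipBehaviour (precisionLaw p F (kind w)) (!ω) (r w).prob x
  rw [Bool.not_not] at this
  exact this

lemma profileMoments_neg (p : ℝ) (F : Measure ℝ) (r : Profile K M) (ω : Bool) (w : Voter K M)
    (x : Action) :
    profileMoments p F (fun v => (r v).neg) ω w x = profileMoments p F r ω w (flipAction x) :=
  rfl

lemma flip_update (z : Voter K M → Action → ℝ) (v : Voter K M) (y : Action → ℝ) :
    (fun w x => Function.update z v y w (flipAction x)) =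
      Function.update (fun w x => z w (flipAction x)) v fun x => y (flipAction x) := by
  funext w
  by_cases hw : w = v
  · subst hw; simp
  · simp [hw]

lemma payoff_flip_update (ω : Bool) (z : Voter K M → Action → ℝ) (v : Voter K M)
    (y : Action → ℝ) :
    payoff ω (Function.update (fun w x => z w (flipAction x)) v y) =
      payoff (!ω) (Function.update z v fun x => y (flipAction x)) := by
  have := payoff_flip (!ω) (Function.update z v fun x => y (flipAction x))
  rw [Bool.not_not] at this
  rw [← this, flip_update]
  simp

section Dominance

variable {p : ℝ} {F : Measure ℝ} [IsProbabilityMeasure F]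

lemma Setting.expectedUtility_update (h : Setting K M p F) (r : Profile K M) (v : Voter K M)
    (s : Strategy v) :
    expectedUtility (1 / 2) p F (Function.update r v s) =
      (payoff true (Function.update (profileMoments p F r true) v
        (moments (precisionLaw p F (kind v)) true s.prob)) +
      payoff false (Function.update (profileMoments p F r false) v
        (moments (precisionLaw p F (kind v)) false s.prob))) / 2 := by
  rw [h.expectedUtility_eq, ← profileMoments_update, ← profileMoments_update]
  rfl

/-- Two strategies that lead to the same votes on average, and differ only in the delegations,
do not dominate one another: reversing the votes of all others reverses the sign of the
comparison. -/
lemma Setting.not_weaklyDominates (h : Setting K M p F) {v : Voter K M} {s' s : Strategy v}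
    (hs : ∀ d, averageMoments (precisionLaw p F (kind v)) s'.prob (.vote d) =
      averageMoments (precisionLaw p F (kind v)) s.prob (.vote d)) :
    ¬ WeaklyDominates (1 / 2) p F v s' s := by
  rintro ⟨hle, r, hlt⟩
  set ν := precisionLaw p F (kind v) with hν
  set Δ : Bool → Action → ℝ := fun ω => moments ν ω s'.prob - moments ν ω s.prob with hΔ
  set Θ : Bool → Action → ℝ := fun ω x => Δ ω x + Δ (!ω) (flipAction x) with hΘ
  -- `Θ` is the change in action probabilities, summed over `r` and the flipped profile; it does not
  -- involve votes.
  have hvote : ∀ ω d, Θ ω (.vote d) = 0 := by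
    intro ω d
    have h1 := hs d
    have h2 := hs (!d)
    simp only [averageMoments, flipAction_vote, Bool.not_not] at h1 h2
    cases ω <;> simp only [hΘ, hΔ, Pi.sub_apply, flipAction_vote, Bool.not_true, Bool.not_false] <;>
      linarith
  have hΘflip : ∀ ω, (fun x => Θ ω (flipAction x)) = Θ ω := by
    intro ω
    funext x
    cases x with
    | vote d => rw [flipAction_vote, hvote, hvote]
    | delegate k => rfl
  have hdiff : ∀ r : Profile K M,
      expectedUtility (1 / 2) p F (Function.update r v s') -
        expectedUtility (1 / 2) p F (Function.update r v s) =
      (payoff true (Function.update (profileMoments p F r true) v (Δ true)) +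
        payoff false (Function.update (profileMoments p F r false) v (Δ false))) / 2 := by
    intro r
    rw [h.expectedUtility_update, h.expectedUtility_update, hΔ]
    simp only [MultilinearMap.map_update_sub]
    ring
  have hpair : ∀ r : Profile K M,
      (expectedUtility (1 / 2) p F (Function.update r v s') -
        expectedUtility (1 / 2) p F (Function.update r v s)) +
      (expectedUtility (1 / 2) p F (Function.update (fun w => (r w).flip) v s') -
        expectedUtility (1 / 2) p F (Function.update (fun w => (r w).flip) v s)) =
      (payoff true (Function.update (profileMoments p F r true) v (Θ true)) +
        payoff false (Function.update (profileMoments p F r false) v (Θ false))) / 2 := by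
    intro r
    rw [hdiff, hdiff]
    have hf : ∀ ω, profileMoments p F (fun v => (r v).flip) ω =
        fun w x => profileMoments p F r (!ω) w (flipAction x) := by
      intro ω
      funext w x
      exact profileMoments_flip p F r ω w x
    rw [hf, hf, payoff_flip_update, payoff_flip_update]
    have hsplit : ∀ ω, Θ ω = Δ ω + fun x => Δ (!ω) (flipAction x) := fun ω => rfl
    rw [hsplit, hsplit, MultilinearMap.map_update_add, MultilinearMap.map_update_add]
    simp only [Bool.not_true, Bool.not_false]
    ring
  -- Reversing the votes of the others exchanges the two decisions, as `Θ` does not involve votes,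
  -- and the two payoffs add up to zero, as `Θ` has total mass zero.
  have hneg : ∀ ω, payoff ω (Function.update (profileMoments p F (fun w => (r w).neg) ω) v (Θ ω)) =
      - payoff ω (Function.update (profileMoments p F r ω) v (Θ ω)) := by
    intro ω
    have hf : profileMoments p F (fun w => (r w).neg) ω =
        fun w x => profileMoments p F r ω w (flipAction x) := rfl
    rw [hf, payoff_flip_update, hΘflip]
    have hsupp : ∀ w, Supported w (Function.update (profileMoments p F r ω) v (Θ ω) w) := by
      intro w
      by_cases hw : w = v
      · subst hw
        rw [Function.update_self]
        intro x hx
        have hx' : ¬ Available w (flipAction x) := by rwa [available_flipAction]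
        simp only [hΘ, hΔ, Pi.sub_apply]
        rw [supported_moments ν ω s' x hx, supported_moments ν ω s x hx,
          supported_moments ν _ s' _ hx', supported_moments ν _ s _ hx']
        ring
      · rw [Function.update_of_ne hw]
        exact supported_moments _ _ _
    have hmass := payoff_add hsupp
    rw [Finset.prod_eq_zero (Finset.mem_univ v)] at hmass
    · cases ω <;> simp only [Bool.not_true, Bool.not_false] <;> linarith
    · have hΔ0 : ∀ ω, ∑ x, Δ ω x = 0 := by
        intro ω
        simp only [hΔ, Pi.sub_apply, Finset.sum_sub_distrib]
        rw [h.sum_moments _ _ s'.isBehaviour, h.sum_moments _ _ s.isBehaviour, sub_self]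
      rw [Function.update_self]
      simp only [hΘ, Finset.sum_add_distrib, hΔ0]
      rw [sum_flipAction (Δ !ω), hΔ0, add_zero]
  have h1 := hpair r
  have h2 := hpair fun w => (r w).neg
  rw [hneg, hneg] at h2
  have h3 := hle fun w => (r w).flip
  have h4 := hle fun w => (r w).neg
  have h5 := hle fun w => ((r w).neg).flip
  linarith

/-- Against a profile that treats the two states alike, only the averaged action probabilities
of `v` matter. -/
lemma Setting.expectedUtility_update_of_symmetric (h : Setting K M p F) {r : Profile K M}
    (hr : ∀ w x, profileMoments p F r false w x = profileMoments p F r true w (flipAction x))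
    (v : Voter K M) (s : Strategy v) :
    expectedUtility (1 / 2) p F (Function.update r v s) =
      payoff true (Function.update (profileMoments p F r true) v
        (averageMoments (precisionLaw p F (kind v)) s.prob)) := by
  have hf : profileMoments p F r false =
      fun w x => profileMoments p F r true w (flipAction x) := by
    funext w x
    exact hr w x
  rw [h.expectedUtility_update, hf, payoff_flip_update, Bool.not_false,
    payoff_update true _ v (averageMoments _ _), payoff_update true _ v (moments _ _ _),
    payoff_update true _ v fun x => moments _ _ _ _, ← Finset.sum_add_distrib, Finset.sum_div]
  refine Finset.sum_congr rfl fun x _ => ?_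
  unfold averageMoments
  ring

/-- If the others vote sincerely, or all against their signals, a dominating strategy must vote
for the right decision at least as often, net of wrong votes. -/
lemma Setting.vote_sub_le_of_dominates (h : Setting K M p F) {r : Profile K M}
    (hr : ∀ w x, profileMoments p F r false w x = profileMoments p F r true w (flipAction x))
    {v : Voter K M}
    (hv : payoff true (Function.update (profileMoments p F r true) v
        (Pi.single (.vote false) 1)) <
      payoff true (Function.update (profileMoments p F r true) v (Pi.single (.vote true) 1)))
    {s' s : Strategy v} (hs : WeaklyDominates (1 / 2) p F v s' s) :
    averageMoments (precisionLaw p F (kind v)) s.prob (.vote true) -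
        averageMoments (precisionLaw p F (kind v)) s.prob (.vote false) ≤
      averageMoments (precisionLaw p F (kind v)) s'.prob (.vote true) -
        averageMoments (precisionLaw p F (kind v)) s'.prob (.vote false) := by
  set z := profileMoments p F r true with hz
  set ν := precisionLaw p F (kind v) with hν
  have hsym : ∀ w x, profileMoments p F (fun u => (r u).neg) false w x =
      profileMoments p F (fun u => (r u).neg) true w (flipAction x) := by
    intro w x
    rw [profileMoments_neg, profileMoments_neg, hr]
  have hzneg : profileMoments p F (fun u => (r u).neg) true = fun w x => z w (flipAction x) := rfl
  have hcompl : ∀ t : Strategy v,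
      payoff true (Function.update (fun w x => z w (flipAction x)) v (averageMoments ν t.prob)) =
        1 - payoff true (Function.update z v fun x => averageMoments ν t.prob (flipAction x)) := by
    intro t
    rw [payoff_flip_update, Bool.not_true]
    have hsupp : ∀ w, Supported w (Function.update z v
        (fun x => averageMoments ν t.prob (flipAction x)) w) := by
      intro w
      by_cases hw : w = v
      · subst hw
        rw [Function.update_self]
        intro x hx
        have hx' : ¬ Available w (flipAction x) := by rwa [available_flipAction]
        simp only [averageMoments, flipAction_flipAction]
        rw [supported_moments ν _ t _ hx', supported_moments ν _ t _ hx]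
        norm_num
      · rw [Function.update_of_ne hw]
        exact supported_moments _ _ _
    have hmass := payoff_add hsupp
    rw [Finset.prod_eq_one] at hmass
    · linarith
    · intro w _
      by_cases hw : w = v
      · subst hw
        rw [Function.update_self]
        simp only [averageMoments, flipAction_flipAction]
        rw [← Finset.sum_div, Finset.sum_add_distrib, h.sum_moments _ _ t.isBehaviour]
        rw [sum_flipAction (moments ν true t.prob), h.sum_moments _ _ t.isBehaviour]
        norm_num
      · rw [Function.update_of_ne hw]
        exact h.sum_moments _ _ (r w).isBehaviour
  have h1 := hs.1 r
  have h2 := hs.1 fun u => (r u).neg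
  rw [h.expectedUtility_update_of_symmetric hr, h.expectedUtility_update_of_symmetric hr,
    payoff_update, payoff_update true _ v (averageMoments _ s'.prob)] at h1
  rw [h.expectedUtility_update_of_symmetric hsym, h.expectedUtility_update_of_symmetric hsym,
    hzneg, hcompl, hcompl, payoff_update, payoff_update true z v fun x =>
      averageMoments ν s'.prob (flipAction x)] at h2
  simp only [sum_action, flipAction_vote, flipAction_delegate, Bool.not_true, Bool.not_false]
    at h1 h2
  refine le_of_mul_le_mul_right ?_ (sub_pos.2 hv)
  linarith

end Dominance

/-! ### Delegation rules -/

/-- Some member of category `k`, and hence every one, can delegate to category `j`. -/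
def CanDelegate (K M : ℕ) (k j : Kind) : Prop :=
  ∃ v : Voter K M, kind v = k ∧ Available v (.delegate j)

lemma kind_swap {v w : Voter K M} (h : kind v = kind w) (x : Voter K M) :
    kind (Equiv.swap v w x) = kind x := by
  rw [Equiv.swap_apply_def]
  split_ifs with h1 h2
  · rw [h1, h]
  · rw [h2, h]
  · rfl

lemma available_delegate_iff (v : Voter K M) (j : Kind) :
    Available v (.delegate j) ↔ CanDelegate K M (kind v) j := by
  refine ⟨fun h => ⟨v, rfl, h⟩, ?_⟩
  rintro ⟨w, hw, u, hu⟩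
  refine ⟨Equiv.swap w v u, ?_⟩
  have := (mem_others_relabel (kind_swap hw) w u j).2 hu
  rwa [Equiv.swap_apply_left] at this

/-- A delegation rule for category `k`: `d q j` is the probability that a voter of precision `q`
delegates to category `j`. -/
structure IsRule (K M : ℕ) (k : Kind) (d : ℝ → Kind → ℝ) : Prop where
  measurable : ∀ j, Measurable fun q => d q j
  nonneg : ∀ q j, 0 ≤ d q j
  sum_le_one : ∀ q, d q .expert + d q .nonExpert ≤ 1
  available : ∀ j, ¬ CanDelegate K M k j → ∀ q, d q j = 0

/-- The probability of voting under a delegation rule. -/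
def voteProb (d : ℝ → Kind → ℝ) (q : ℝ) : ℝ := 1 - d q .expert - d q .nonExpert

/-- The behaviour that delegates according to `d` and otherwise votes according to the signal. -/
def ruleProb (d : ℝ → Kind → ℝ) (q : ℝ) (σ : Bool) : Action → ℝ
  | .vote c => if c = σ then voteProb d q else 0
  | .delegate j => d q j

lemma IsRule.voteProb_nonneg {k : Kind} {d : ℝ → Kind → ℝ} (h : IsRule K M k d) (q : ℝ) :
    0 ≤ voteProb d q := by
  unfold voteProb
  linarith [h.sum_le_one q]

lemma IsRule.voteProb_le_one {k : Kind} {d : ℝ → Kind → ℝ} (h : IsRule K M k d) (q : ℝ) :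
    voteProb d q ≤ 1 := by
  unfold voteProb
  linarith [h.nonneg q .expert, h.nonneg q .nonExpert]

lemma IsRule.le_one {k : Kind} {d : ℝ → Kind → ℝ} (h : IsRule K M k d) (q : ℝ) (j : Kind) :
    d q j ≤ 1 := by
  cases j <;> linarith [h.nonneg q .expert, h.nonneg q .nonExpert, h.sum_le_one q]

lemma IsRule.measurable_voteProb {k : Kind} {d : ℝ → Kind → ℝ} (h : IsRule K M k d) :
    Measurable (voteProb d) :=
  (measurable_const.sub (h.measurable .expert)).sub (h.measurable .nonExpert)

/-- The strategy that delegates according to `d` and otherwise votes according to the signal. -/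
def ruleStrategy (v : Voter K M) (d : ℝ → Kind → ℝ) (h : IsRule K M (kind v) d) :
    Strategy v where
  prob := ruleProb d
  nonneg q σ x := by
    cases x with
    | vote c =>
      simp only [ruleProb]
      split_ifs
      · exact h.voteProb_nonneg q
      · exact le_rfl
    | delegate j => exact h.nonneg q j
  sum_eq_one q σ := by
    rw [sum_action]
    cases σ <;> simp [ruleProb, voteProb] <;> ring
  available q σ x hx := by
    cases x with
    | vote c => exact absurd trivial hx
    | delegate j =>
      rw [available_delegate_iff] at hx
      exact h.available j hx q
  measurable σ x := by
    cases x with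
    | vote c =>
      simp only [ruleProb]
      split_ifs
      · exact h.measurable_voteProb
      · exact measurable_const
    | delegate j => exact h.measurable j

/-- The action probabilities, in the state `true`, of a voter who follows the rule `d`. -/
noncomputable def ruleVector (ν : Measure ℝ) (d : ℝ → Kind → ℝ) : Action → ℝ
  | .vote c => ∫ q, voteProb d q * (if c then q else 1 - q) ∂ν
  | .delegate j => ∫ q, d q j ∂ν

lemma moments_ruleProb (ν : Measure ℝ) (d : ℝ → Kind → ℝ) :
    moments ν true (ruleProb d) = ruleVector ν d := by
  funext x
  unfold moments
  cases x with
  | vote c => cases c <;> simp [ruleVector, ruleProb, signalProb, mul_comm]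
  | delegate j => simp [ruleVector, ruleProb, signalProb, ← add_mul]

lemma moments_ruleProb_false (ν : Measure ℝ) (d : ℝ → Kind → ℝ) (x : Action) :
    moments ν false (ruleProb d) x = ruleVector ν d (flipAction x) := by
  rw [← moments_ruleProb]
  have : flipBehaviour (ruleProb d) = ruleProb d := by
    funext q σ x
    cases x with
    | vote c => cases c <;> cases σ <;> simp [flipBehaviour, ruleProb]
    | delegate j => rfl
  conv_lhs => rw [← this]
  exact moments_flipBehaviour ν true (ruleProb d) x

lemma averageMoments_ruleProb (ν : Measure ℝ) (d : ℝ → Kind → ℝ) :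
    averageMoments ν (ruleProb d) = ruleVector ν d := by
  funext x
  simp [averageMoments, moments_ruleProb, moments_ruleProb_false]

/-- The delegation rule that averages a behaviour over the two signals. -/
noncomputable def averageRule (f : ℝ → Bool → Action → ℝ) (q : ℝ) (j : Kind) : ℝ :=
  (f q true (.delegate j) + f q false (.delegate j)) / 2

lemma isRule_averageRule {v : Voter K M} (s : Strategy v) :
    IsRule K M (kind v) (averageRule s.prob) where
  measurable j := ((s.measurable _ _).add (s.measurable _ _)).div_const 2
  nonneg q j := by
    have h1 := s.nonneg q true (.delegate j)
    have h2 := s.nonneg q false (.delegate j)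
    unfold averageRule
    positivity
  sum_le_one q := by
    have h1 := s.sum_eq_one q true
    have h2 := s.sum_eq_one q false
    rw [sum_action] at h1 h2
    unfold averageRule
    linarith [s.nonneg q true (.vote true), s.nonneg q true (.vote false),
      s.nonneg q false (.vote true), s.nonneg q false (.vote false)]
  available j hj q := by
    rw [← available_delegate_iff] at hj
    simp [averageRule, s.available _ _ _ hj]

lemma Setting.ruleVector_nonneg {p : ℝ} {F : Measure ℝ} (h : Setting K M p F) {k : Kind}
    {d : ℝ → Kind → ℝ} (hd : IsRule K M k d) (x : Action) :
    0 ≤ ruleVector (precisionLaw p F k) d x := by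
  cases x with
  | vote c =>
    refine integral_nonneg_of_ae ?_
    filter_upwards [h.ae_mem k] with q hq
    refine mul_nonneg (hd.voteProb_nonneg q) ?_
    have := h.lt_one
    split_ifs <;> linarith [hq.1, hq.2]
  | delegate j => exact integral_nonneg fun q => hd.nonneg q j

section Rules

variable {p : ℝ} {F : Measure ℝ} [IsProbabilityMeasure F]

lemma Setting.integrable_voteProb_mul (h : Setting K M p F) {k k' : Kind} {d : ℝ → Kind → ℝ}
    (hd : IsRule K M k' d) (c : Bool) :
    Integrable (fun q => voteProb d q * (if c then q else 1 - q)) (precisionLaw p F k) := by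
  refine h.integrable_of_bounded k (hd.measurable_voteProb.mul ?_) 1 fun q hq => ?_
  · split_ifs <;> fun_prop
  · have := h.lt_one
    have h1 := hd.voteProb_nonneg q
    have h2 := hd.voteProb_le_one q
    rw [abs_le]
    split_ifs <;> constructor <;> nlinarith [hq.1, hq.2]

lemma Setting.integrable_rule (h : Setting K M p F) {k k' : Kind} {d : ℝ → Kind → ℝ}
    (hd : IsRule K M k' d) (j : Kind) :
    Integrable (fun q => d q j) (precisionLaw p F k) := by
  refine h.integrable_of_bounded k (hd.measurable j) 1 fun q _ => ?_
  rw [abs_of_nonneg (hd.nonneg q j)]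
  exact hd.le_one q j

lemma Setting.integrable_voteProb (h : Setting K M p F) {k k' : Kind} {d : ℝ → Kind → ℝ}
    (hd : IsRule K M k' d) : Integrable (voteProb d) (precisionLaw p F k) :=
  ((integrable_const 1).sub (h.integrable_rule hd .expert)).sub (h.integrable_rule hd .nonExpert)

lemma Setting.ruleVector_vote_add (h : Setting K M p F) {k : Kind} {d : ℝ → Kind → ℝ}
    (hd : IsRule K M k d) :
    ruleVector (precisionLaw p F k) d (.vote true) +
      ruleVector (precisionLaw p F k) d (.vote false) = ∫ q, voteProb d q ∂precisionLaw p F k := by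
  refine (integral_add (h.integrable_voteProb_mul hd true)
    (h.integrable_voteProb_mul hd false)).symm.trans ?_
  congr 1
  funext q
  simp
  ring

lemma Setting.ruleVector_vote_sub (h : Setting K M p F) {k : Kind} {d : ℝ → Kind → ℝ}
    (hd : IsRule K M k d) :
    ruleVector (precisionLaw p F k) d (.vote true) -
      ruleVector (precisionLaw p F k) d (.vote false) =
      ∫ q, voteProb d q * (2 * q - 1) ∂precisionLaw p F k := by
  refine (integral_sub (h.integrable_voteProb_mul hd true)
    (h.integrable_voteProb_mul hd false)).symm.trans ?_
  congr 1
  funext q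
  simp
  ring

lemma Setting.averageMoments_delegate (h : Setting K M p F) {v : Voter K M} (s : Strategy v)
    (j : Kind) :
    averageMoments (precisionLaw p F (kind v)) s.prob (.delegate j) =
      ruleVector (precisionLaw p F (kind v)) (averageRule s.prob) (.delegate j) := by
  simp only [averageMoments, ruleVector, flipAction_delegate, moments]
  rw [← integral_add (h.integrable_moments _ true s.isBehaviour _)
    (h.integrable_moments _ false s.isBehaviour _), ← integral_div]
  congr 1
  funext q
  simp [signalProb, averageRule]
  ring

lemma Setting.averageMoments_vote_add (h : Setting K M p F) {v : Voter K M} (s : Strategy v) :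
    averageMoments (precisionLaw p F (kind v)) s.prob (.vote true) +
        averageMoments (precisionLaw p F (kind v)) s.prob (.vote false) =
      ruleVector (precisionLaw p F (kind v)) (averageRule s.prob) (.vote true) +
        ruleVector (precisionLaw p F (kind v)) (averageRule s.prob) (.vote false) := by
  have h1 := h.sum_moments (kind v) true s.isBehaviour
  have h2 := h.sum_moments (kind v) false s.isBehaviour
  have h3 := h.sum_moments (kind v) true (ruleStrategy v _ (isRule_averageRule s)).isBehaviour
  have h4 := h.averageMoments_delegate s .expert
  have h5 := h.averageMoments_delegate s .nonExpert
  change ∑ x, moments _ true (ruleProb _) x = 1 at h3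
  rw [moments_ruleProb] at h3
  rw [sum_action] at h1 h2 h3
  rw [← h4, ← h5] at h3
  simp only [averageMoments, flipAction_vote, flipAction_delegate, Bool.not_true,
    Bool.not_false] at h3 ⊢
  linarith

/-- Precisions being at least one half, a vote against the signal is less often right. -/
lemma Setting.averageMoments_vote_le (h : Setting K M p F) {v : Voter K M} (s : Strategy v) :
    averageMoments (precisionLaw p F (kind v)) s.prob (.vote true) ≤
      ruleVector (precisionLaw p F (kind v)) (averageRule s.prob) (.vote true) := by
  simp only [averageMoments, ruleVector, flipAction_vote, moments]
  rw [← integral_add (h.integrable_moments _ true s.isBehaviour _)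
    (h.integrable_moments _ false s.isBehaviour _), ← integral_div]
  refine integral_mono_ae (((h.integrable_moments _ true s.isBehaviour _).add
    (h.integrable_moments _ false s.isBehaviour _)).div_const 2)
    (h.integrable_voteProb_mul (isRule_averageRule s) true) ?_
  filter_upwards [h.ae_mem (kind v)] with q hq
  have h1 := s.sum_eq_one q true
  have h2 := s.sum_eq_one q false
  rw [sum_action] at h1 h2
  have h3 := s.nonneg q true (.vote false)
  have h4 := s.nonneg q false (.vote true)
  have h5 : voteProb (averageRule s.prob) q =
      (s.prob q true (.vote true) + s.prob q true (.vote false) +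
        s.prob q false (.vote true) + s.prob q false (.vote false)) / 2 := by
    simp only [voteProb, averageRule]
    linarith
  rw [h5]
  simp only [signalProb, Fintype.sum_bool, Bool.not_true, if_true, Bool.false_eq_true, if_false,
    Bool.true_eq_false]
  nlinarith [mul_nonneg (sub_nonneg.2 hq.1) h3, mul_nonneg (sub_nonneg.2 hq.1) h4]

end Rules

/-- With the same delegations and the same frequency of voting, more right votes are better. -/
lemma payoff_update_le_of_vote_le {z : Voter K M → Action → ℝ} (hz : ∀ w x, 0 ≤ z w x)
    (v : Voter K M) {y y' : Action → ℝ} (hdel : ∀ j, y (.delegate j) = y' (.delegate j))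
    (hadd : y (.vote true) + y (.vote false) = y' (.vote true) + y' (.vote false))
    (hle : y (.vote true) ≤ y' (.vote true)) :
    payoff true (Function.update z v y) ≤ payoff true (Function.update z v y') := by
  have h := payoff_vote_mono true v (z := z) fun w _ => hz w
  rw [payoff_update, payoff_update true z v y', sum_action, sum_action, hdel, hdel]
  simp only [Bool.not_true] at h
  have hF : y (.vote false) = y' (.vote true) + y' (.vote false) - y (.vote true) := by linarith
  rw [hF]
  nlinarith [mul_nonneg (sub_nonneg.2 hle) (sub_nonneg.2 h)]

/-! ### Symmetric profiles -/

/-- The profile in which voter `v` follows the rule `D v`. -/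
def ruleProfile (D : Voter K M → ℝ → Kind → ℝ) (h : ∀ v, IsRule K M (kind v) (D v)) :
    Profile K M := fun v => ruleStrategy v (D v) (h v)

lemma profileMoments_ruleProfile (p : ℝ) (F : Measure ℝ) (D : Voter K M → ℝ → Kind → ℝ)
    (h : ∀ v, IsRule K M (kind v) (D v)) :
    profileMoments p F (ruleProfile D h) true =
      fun v => ruleVector (precisionLaw p F (kind v)) (D v) := by
  funext v
  exact moments_ruleProb _ _

lemma profileMoments_ruleProfile_false (p : ℝ) (F : Measure ℝ) (D : Voter K M → ℝ → Kind → ℝ)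
    (h : ∀ v, IsRule K M (kind v) (D v)) (w : Voter K M) (x : Action) :
    profileMoments p F (ruleProfile D h) false w x =
      profileMoments p F (ruleProfile D h) true w (flipAction x) := by
  rw [profileMoments_ruleProfile]
  exact moments_ruleProb_false _ _ _

/-- The ex ante payoff when all members of category `k` follow the rule `D k`. -/
noncomputable def ruleValue (K M : ℕ) (p : ℝ) (F : Measure ℝ) (D : Kind → ℝ → Kind → ℝ) : ℝ :=
  payoff true fun v : Voter K M => ruleVector (precisionLaw p F (kind v)) (D (kind v))

lemma payoff_update_eq_of_kind_eq (ω : Bool) (Z : Kind → Action → ℝ) {v w : Voter K M}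
    (h : kind v = kind w) (y : Action → ℝ) :
    payoff ω (Function.update (fun u : Voter K M => Z (kind u)) w y) =
      payoff ω (Function.update (fun u : Voter K M => Z (kind u)) v y) := by
  rw [← payoff_relabel ω (kind_swap h)]
  congr 1
  funext u
  by_cases hu : u = v
  · subst hu; simp
  · have : Equiv.swap v w u ≠ w := by
      intro h'
      exact hu ((Equiv.swap v w).injective (h'.trans (Equiv.swap_apply_left v w).symm))
    simp [hu, this, kind_swap h]

lemma hasDerivAt_payoff (ω : Bool) (z D : Voter K M → Action → ℝ) :
    HasDerivAt (fun t : ℝ => payoff ω fun w => z w + t • D w)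
      (∑ w, payoff ω (Function.update z w (D w))) 0 := by
  classical
  have h1 : ∀ a : Voter K M → Action, HasDerivAt
      (fun t : ℝ => (∏ w, (z w (a w) + t * D w (a w))) * decisionProb a ω)
      ((∑ w, (∏ u ∈ Finset.univ.erase w, z u (a u)) * D w (a w)) * decisionProb a ω) 0 := by
    intro a
    have h2 : ∀ w ∈ (Finset.univ : Finset (Voter K M)),
        HasDerivAt (fun t : ℝ => z w (a w) + t * D w (a w)) (D w (a w)) 0 := by
      intro w _
      simpa using ((hasDerivAt_id (0 : ℝ)).mul_const (D w (a w))).const_add (z w (a w))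
    have h3 := (HasDerivAt.fun_finsetProd h2).mul_const (decisionProb a ω)
    simpa using h3
  have h4 := HasDerivAt.fun_sum fun (a : Voter K M → Action) (_ : a ∈ Finset.univ) => h1 a
  have e1 : (fun t : ℝ => payoff ω fun w => z w + t • D w) =
      fun t => ∑ a : Voter K M → Action,
        (∏ w, (z w (a w) + t * D w (a w))) * decisionProb a ω := by
    funext t
    rw [payoff_apply]
    simp
  have e2 : ∑ w, payoff ω (Function.update z w (D w)) = ∑ a : Voter K M → Action,
      (∑ w, (∏ u ∈ Finset.univ.erase w, z u (a u)) * D w (a w)) * decisionProb a ω := by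
    simp only [payoff_apply, Finset.sum_mul]
    rw [Finset.sum_comm]
    refine Finset.sum_congr rfl fun a _ => Finset.sum_congr rfl fun w _ => ?_
    congr 1
    rw [← Finset.prod_erase_mul _ _ (Finset.mem_univ w), Function.update_self]
    congr 1
    refine Finset.prod_congr rfl fun u hu => ?_
    rw [Function.update_of_ne (Finset.ne_of_mem_erase hu)]
  rw [e1, e2]
  exact h4

lemma nonpos_of_hasDerivAt_of_le {f : ℝ → ℝ} {f' : ℝ} (hf : HasDerivAt f f' 0)
    (h : ∀ t ∈ Set.Ioo (0 : ℝ) 1, f t ≤ f 0) : f' ≤ 0 := by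
  have h1 := (hasDerivWithinAt_iff_tendsto_slope' (s := Set.Ioi (0 : ℝ)) (by simp)).1
    hf.hasDerivWithinAt
  refine le_of_tendsto h1 ?_
  filter_upwards [Ioo_mem_nhdsGT (zero_lt_one' ℝ)] with t ht
  rw [slope_def_field]
  exact div_nonpos_of_nonpos_of_nonneg (sub_nonpos.2 (h t ht)) (by linarith [ht.1])

/-- In a common interest game, a direction that is unprofitable when a whole category moves
towards it is unprofitable for each of its members. -/
lemma payoff_update_le_of_forall_mix (ω : Bool) (Z : Kind → Action → ℝ) (y : Action → ℝ)
    (v : Voter K M)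
    (hmax : ∀ t ∈ Set.Ioo (0 : ℝ) 1,
      payoff ω (fun w : Voter K M => Z (kind w) +
        t • if kind w = kind v then y - Z (kind v) else 0) ≤
      payoff ω fun w : Voter K M => Z (kind w)) :
    payoff ω (Function.update (fun w : Voter K M => Z (kind w)) v y) ≤
      payoff ω fun w : Voter K M => Z (kind w) := by
  classical
  have h1 := hasDerivAt_payoff ω (fun w : Voter K M => Z (kind w))
    fun w => if kind w = kind v then y - Z (kind v) else 0
  have h2 := nonpos_of_hasDerivAt_of_le h1 fun t ht => by simpa using hmax t ht
  have h3 : ∀ w : Voter K M, payoff ω (Function.update (fun w : Voter K M => Z (kind w)) w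
      (if kind w = kind v then y - Z (kind v) else 0)) =
      if kind w = kind v then payoff ω (Function.update (fun w : Voter K M => Z (kind w)) v
        (y - Z (kind v))) else 0 := by
    intro w
    split_ifs with hw
    · exact payoff_update_eq_of_kind_eq ω Z hw.symm _
    · exact MultilinearMap.map_update_zero _ _ _
  simp only [h3] at h2
  rw [← Finset.sum_filter, Finset.sum_const, nsmul_eq_mul] at h2
  have hcard : 0 < (Finset.univ.filter fun w : Voter K M => kind w = kind v).card :=
    Finset.card_pos.2 ⟨v, by simp⟩
  have h4 := nonpos_of_mul_nonpos_right h2 (Nat.cast_pos.2 hcard)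
  rw [MultilinearMap.map_update_sub] at h4
  have h5 : Function.update (fun w : Voter K M => Z (kind w)) v (Z (kind v)) =
      fun w => Z (kind w) := Function.update_eq_self v _
  rw [h5] at h4
  linarith

/-! ### Optimal rules -/

/-- The rules `D` maximize the common payoff among all pairs of rules. -/
def IsOptimal (K M : ℕ) (p : ℝ) (F : Measure ℝ) (D : Kind → ℝ → Kind → ℝ) : Prop :=
  ∀ D' : Kind → ℝ → Kind → ℝ, (∀ k, IsRule K M k (D' k)) →
    ruleValue K M p F D' ≤ ruleValue K M p F D

section Optimal

variable {p : ℝ} {F : Measure ℝ} [IsProbabilityMeasure F] {D : Kind → ℝ → Kind → ℝ}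

lemma isRule_update (hD : ∀ k, IsRule K M k (D k)) {k : Kind} {d : ℝ → Kind → ℝ}
    (hd : IsRule K M k d) (j : Kind) : IsRule K M j (Function.update D k d j) := by
  by_cases hj : j = k
  · subst hj; simpa using hd
  · simpa [hj] using hD j

/-- At an optimal pair of rules no voter gains by following another rule on her own. -/
lemma Setting.payoff_update_le_of_isOptimal (h : Setting K M p F)
    (hD : ∀ k, IsRule K M k (D k)) (hopt : IsOptimal K M p F D) (v : Voter K M)
    {d : ℝ → Kind → ℝ} (hd : IsRule K M (kind v) d) :
    payoff true (Function.update
        (fun w : Voter K M => ruleVector (precisionLaw p F (kind w)) (D (kind w))) v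
        (ruleVector (precisionLaw p F (kind v)) d)) ≤ ruleValue K M p F D := by
  refine payoff_update_le_of_forall_mix true
    (fun k => ruleVector (precisionLaw p F k) (D k)) _ v fun t ht => ?_
  set k := kind v with hk
  set m : ℝ → Kind → ℝ := fun q j => (1 - t) * D k q j + t * d q j with hm
  have hmv : ∀ q, voteProb m q = (1 - t) * voteProb (D k) q + t * voteProb d q := by
    intro q
    simp only [voteProb, hm]
    ring
  have hrule : IsRule K M k m := by
    refine ⟨fun j => ?_, fun q j => ?_, fun q => ?_, fun j hj q => ?_⟩
    · exact (((hD k).measurable j).const_mul _).add ((hd.measurable j).const_mul _)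
    · exact add_nonneg (mul_nonneg (by linarith [ht.2]) ((hD k).nonneg q j))
        (mul_nonneg ht.1.le (hd.nonneg q j))
    · have h1 := mul_le_mul_of_nonneg_left ((hD k).sum_le_one q) (sub_nonneg.2 ht.2.le)
      have h2 := mul_le_mul_of_nonneg_left (hd.sum_le_one q) ht.1.le
      simp only [hm]
      linarith
    · simp [hm, (hD k).available j hj q, hd.available j hj q]
  have hvec : ruleVector (precisionLaw p F k) m = ruleVector (precisionLaw p F k) (D k) +
      t • (ruleVector (precisionLaw p F k) d - ruleVector (precisionLaw p F k) (D k)) := by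
    have : ∀ A B : ℝ, (1 - t) * A + t * B = A + t * (B - A) := fun A B => by ring
    funext x
    cases x with
    | vote c =>
      simp only [ruleVector, Pi.add_apply, Pi.smul_apply, Pi.sub_apply, smul_eq_mul]
      rw [← this, ← integral_const_mul, ← integral_const_mul, ← integral_add
        ((h.integrable_voteProb_mul (hD k) c).const_mul _)
        ((h.integrable_voteProb_mul hd c).const_mul _)]
      congr 1
      funext q
      rw [hmv]
      ring
    | delegate j =>
      simp only [ruleVector, Pi.add_apply, Pi.smul_apply, Pi.sub_apply, smul_eq_mul]
      rw [← this, ← integral_const_mul, ← integral_const_mul, ← integral_add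
        ((h.integrable_rule (hD k) j).const_mul _) ((h.integrable_rule hd j).const_mul _)]
  have := hopt (Function.update D k m) (isRule_update hD hrule)
  unfold ruleValue at this
  convert this using 3 with w
  by_cases hw : kind w = k
  · rw [if_pos hw, hw, Function.update_self, hvec]
  · rw [if_neg hw, Function.update_of_ne hw, smul_zero, add_zero]

/-- If a strategy dominates the rule of a category, the category as a whole can adopt its
sincere average without loss. -/
lemma Setting.ruleValue_le_of_weaklyDominates (h : Setting K M p F)
    (hD : ∀ k, IsRule K M k (D k)) {v : Voter K M} {s' : Strategy v}
    (hs : WeaklyDominates (1 / 2) p F v s' (ruleStrategy v (D (kind v)) (hD (kind v)))) :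
    ruleValue K M p F D ≤
      ruleValue K M p F (Function.update D (kind v) (averageRule s'.prob)) := by
  classical
  set k := kind v with hk
  set d := averageRule s'.prob with hd
  have hdr : IsRule K M k d := isRule_averageRule s'
  set z : Voter K M → Action → ℝ := fun w => ruleVector (precisionLaw p F (kind w)) (D (kind w))
    with hz
  set z' : Voter K M → Action → ℝ := fun w =>
    ruleVector (precisionLaw p F (kind w)) (Function.update D k d (kind w)) with hz'
  -- The claim for `v`, against others who follow the old or the new rule.
  have hstep : ∀ u : Voter K M → Action → ℝ, (∀ w, u w = z w ∨ u w = z' w) →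
      payoff true (Function.update u v (z v)) ≤ payoff true (Function.update u v (z' v)) := by
    intro u hu
    set E : Voter K M → ℝ → Kind → ℝ := fun w =>
      if u w = z w then D (kind w) else Function.update D k d (kind w) with hE
    have hEr : ∀ w, IsRule K M (kind w) (E w) := by
      intro w
      simp only [hE]
      split_ifs
      · exact hD _
      · exact isRule_update hD hdr _
    have hEu : profileMoments p F (ruleProfile E hEr) true = u := by
      rw [profileMoments_ruleProfile]
      funext w
      simp only [hE]
      split_ifs with hw
      · exact hw.symm
      · exact ((hu w).resolve_left hw).symm
    have h1 := hs.1 (ruleProfile E hEr)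
    rw [h.expectedUtility_update_of_symmetric (profileMoments_ruleProfile_false p F E hEr),
      h.expectedUtility_update_of_symmetric (profileMoments_ruleProfile_false p F E hEr), hEu] at h1
    have h2 : averageMoments (precisionLaw p F (kind v))
        (ruleStrategy v (D (kind v)) (hD (kind v))).prob = z v := averageMoments_ruleProb _ _
    rw [h2] at h1
    refine h1.trans (payoff_update_le_of_vote_le ?_ v ?_ ?_ ?_)
    · intro w x
      rcases hu w with hw | hw <;> rw [hw]
      · exact h.ruleVector_nonneg (hD _) x
      · exact h.ruleVector_nonneg (isRule_update hD hdr _) x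
    · intro j
      simp only [hz', ← hk, Function.update_self]
      exact h.averageMoments_delegate s' j
    · simp only [hz', ← hk, Function.update_self]
      exact h.averageMoments_vote_add s'
    · simp only [hz', ← hk, Function.update_self]
      exact h.averageMoments_vote_le s'
  refine payoff_le_of_forall_update true fun w u hu => ?_
  by_cases hw : kind w = k
  · -- Exchange the roles of `v` and `w`.
    have hsw : ∀ x, kind (Equiv.swap v w x) = kind x := kind_swap (hk.symm.trans hw.symm)
    have hz0 : ∀ x, z (Equiv.swap v w x) = z x := by
      intro x
      simp only [hz, hsw]
    have hz1 : ∀ x, z' (Equiv.swap v w x) = z' x := by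
      intro x
      simp only [hz', hsw]
    have h1 := hstep (fun x => u (Equiv.swap v w x)) fun x => by
      rw [← hz0, ← hz1]
      exact hu _
    have h2 : ∀ y : Action → ℝ, payoff true (Function.update u w y) =
        payoff true (Function.update (fun x => u (Equiv.swap v w x)) v y) := by
      intro y
      rw [← payoff_relabel true hsw]
      congr 1
      funext x
      by_cases hx : x = v
      · subst hx; simp
      · have : Equiv.swap v w x ≠ w := by
          intro h'
          exact hx ((Equiv.swap v w).injective (h'.trans (Equiv.swap_apply_left v w).symm))
        simp [hx, this]
    have h3 : z w = z v := by rw [← hz0 v, Equiv.swap_apply_left]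
    have h4 : z' w = z' v := by rw [← hz1 v, Equiv.swap_apply_left]
    change payoff true (Function.update u w (z w)) ≤ payoff true (Function.update u w (z' w))
    rw [h2, h2, h3, h4]
    exact h1
  · rw [Function.update_of_ne hw]

end Optimal

/-! ### Cutoff rules -/

/-- The rule with delegation probabilities `a` to experts and `b` to non-experts, whatever the
precision. -/
def constRule (a b : ℝ) (_ : ℝ) : Kind → ℝ
  | .expert => a
  | .nonExpert => b

/-- The rule of voting from precision `c` on, and of delegating below `c` to experts with
probability `l` and to non-experts otherwise. With `c = p`, precision `p` delegates too:
voting has probability zero then, and its optimality at `p` could not be inferred. -/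
noncomputable def cutoffRule (p c l : ℝ) (q : ℝ) : Kind → ℝ
  | .expert => if c ≤ q ∧ c < p then 0 else l
  | .nonExpert => if c ≤ q ∧ c < p then 0 else 1 - l

lemma voteProb_cutoffRule (p c l q : ℝ) :
    voteProb (cutoffRule p c l) q = if c ≤ q ∧ c < p then 1 else 0 := by
  simp only [voteProb, cutoffRule]
  split_ifs <;> ring

/-- The integral of `g` over the precisions from `c` on. -/
noncomputable def tail (F : Measure ℝ) (g : ℝ → ℝ) (c : ℝ) : ℝ :=
  ∫ q, (Set.Ici c).indicator g q ∂F

section Setting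

variable {p : ℝ} {F : Measure ℝ}

lemma Setting.two_le (h : Setting K M p F) : 2 ≤ M := by
  obtain ⟨a, ha⟩ := h.odd_total
  obtain ⟨b, hb⟩ := h.odd_experts
  have := h.pos_nonExperts
  omega

lemma Setting.canDelegate (h : Setting K M p F) {k j : Kind} (hkj : ¬ (k = .expert ∧ j = .expert)) :
    CanDelegate K M k j := by
  have hK : 0 < K := h.odd_experts.pos
  have hM := h.two_le
  cases k <;> cases j
  · exact absurd ⟨rfl, rfl⟩ hkj
  · exact ⟨Sum.inl ⟨0, hK⟩, rfl, Sum.inr ⟨0, by omega⟩,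
      Finset.mem_filter.2 ⟨Finset.mem_univ _, by simp, rfl⟩⟩
  · exact ⟨Sum.inr ⟨0, by omega⟩, rfl, Sum.inl ⟨0, hK⟩,
      Finset.mem_filter.2 ⟨Finset.mem_univ _, by simp, rfl⟩⟩
  · exact ⟨Sum.inr ⟨0, by omega⟩, rfl, Sum.inr ⟨1, by omega⟩,
      Finset.mem_filter.2 ⟨Finset.mem_univ _, by simp, rfl⟩⟩

lemma isRule_constRule (h : Setting K M p F) {a b : ℝ} (ha : 0 ≤ a) (hb : 0 ≤ b)
    (hab : a + b ≤ 1) (h0 : ¬ CanDelegate K M .expert .expert → a = 0) :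
    IsRule K M .expert (constRule a b) where
  measurable j := by cases j <;> exact measurable_const
  nonneg q j := by cases j <;> assumption
  sum_le_one q := hab
  available j hj q := by
    cases j
    · exact h0 hj
    · exact absurd (h.canDelegate (by simp)) hj

lemma isRule_cutoffRule (h : Setting K M p F) {c l : ℝ} (hl : l ∈ Set.Icc (0 : ℝ) 1) :
    IsRule K M .nonExpert (cutoffRule p c l) where
  measurable j := by
    have : MeasurableSet {q : ℝ | c ≤ q ∧ c < p} := by
      by_cases hc : c < p
      · have : {q : ℝ | c ≤ q ∧ c < p} = Set.Ici c := by
          ext q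
          simp [hc]
        rw [this]
        exact measurableSet_Ici
      · simp [hc]
    cases j <;> exact Measurable.ite this measurable_const measurable_const
  nonneg q j := by
    cases j <;> simp only [cutoffRule] <;> split_ifs <;> linarith [hl.1, hl.2]
  sum_le_one q := by
    simp only [cutoffRule]
    split_ifs <;> linarith
  available j hj := absurd (h.canDelegate (by simp)) hj

lemma Setting.tail_half (h : Setting K M p F) (g : ℝ → ℝ) : tail F g (1 / 2) = ∫ q, g q ∂F := by
  refine integral_congr_ae ?_
  filter_upwards [h.ae_mem .nonExpert] with q hq
  exact Set.indicator_of_mem hq.1 g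

lemma Setting.ae_lt (h : Setting K M p F) : ∀ᵐ q ∂F, q < p := by
  have hne : ∀ᵐ q ∂F, q ≠ p := by
    rw [ae_iff]
    simpa using h.noAtoms p
  filter_upwards [hne, h.ae_mem .nonExpert] with q hq hq'
  exact lt_of_le_of_ne hq'.2 hq

lemma Setting.tail_top (h : Setting K M p F) (g : ℝ → ℝ) : tail F g p = 0 := by
  refine integral_eq_zero_of_ae ?_
  filter_upwards [h.ae_lt] with q hq
  exact Set.indicator_of_notMem (by simpa using hq) g

lemma Setting.ae_voteProb_cutoffRule (h : Setting K M p F) (c l : ℝ) :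
    ∀ᵐ q ∂F, ∀ y : ℝ, voteProb (cutoffRule p c l) q * y = (Set.Ici c).indicator (fun _ => y) q := by
  filter_upwards [h.ae_lt] with q hq y
  rw [voteProb_cutoffRule]
  by_cases hcq : c ≤ q
  · rw [if_pos ⟨hcq, hcq.trans_lt hq⟩, one_mul, Set.indicator_of_mem (by simpa using hcq)]
  · rw [if_neg fun h => hcq h.1, zero_mul, Set.indicator_of_notMem (by simpa using hcq)]

/-- The pair of rules with parameters `θ = (a, b, c, l)`. -/
noncomputable def paramRules (p : ℝ) (θ : ℝ × ℝ × ℝ × ℝ) : Kind → ℝ → Kind → ℝ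
  | .expert => constRule θ.1 θ.2.1
  | .nonExpert => cutoffRule p θ.2.2.1 θ.2.2.2

/-- The admissible parameters. -/
def paramSet (K M : ℕ) (p : ℝ) : Set (ℝ × ℝ × ℝ × ℝ) :=
  (Set.Icc 0 1 ×ˢ Set.Icc 0 1 ×ˢ Set.Icc (1 / 2) p ×ˢ Set.Icc 0 1) ∩
    {θ | θ.1 + θ.2.1 ≤ 1 ∧ (¬ CanDelegate K M .expert .expert → θ.1 = 0)}

lemma isCompact_paramSet (K M : ℕ) (p : ℝ) : IsCompact (paramSet K M p) := by
  refine IsCompact.inter_right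
    (isCompact_Icc.prod (isCompact_Icc.prod (isCompact_Icc.prod isCompact_Icc))) ?_
  refine IsClosed.inter (isClosed_le (f := fun θ : ℝ × ℝ × ℝ × ℝ => θ.1 + θ.2.1) (by fun_prop)
    continuous_const) ?_
  change IsClosed {θ : ℝ × ℝ × ℝ × ℝ | ¬ CanDelegate K M .expert .expert → θ.1 = 0}
  by_cases hc : CanDelegate K M .expert .expert
  · simp [hc]
  · simpa [hc] using (isClosed_eq continuous_fst continuous_const :
      IsClosed {θ : ℝ × ℝ × ℝ × ℝ | θ.1 = 0})

lemma Setting.isRule_paramRules (h : Setting K M p F) {θ : ℝ × ℝ × ℝ × ℝ}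
    (hθ : θ ∈ paramSet K M p) (k : Kind) : IsRule K M k (paramRules p θ k) := by
  obtain ⟨⟨h1, h2, h3, h4⟩, h5, h6⟩ := hθ
  cases k
  · exact isRule_constRule h h1.1 h2.1 h5 h6
  · exact isRule_cutoffRule h h4

lemma Setting.continuous_tail (h : Setting K M p F) {g : ℝ → ℝ} (hg : Integrable g F) :
    Continuous (tail F g) := by
  rw [continuous_iff_continuousAt]
  intro c
  refine continuousAt_of_dominated (bound := fun q => |g q|) ?_ ?_ hg.abs ?_
  · exact Filter.Eventually.of_forall fun c =>
      (hg.indicator measurableSet_Ici).aestronglyMeasurable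
  · exact Filter.Eventually.of_forall fun c => Filter.Eventually.of_forall fun q =>
      norm_indicator_le_norm_self g q
  · have hne : ∀ᵐ q ∂F, q ≠ c := by
      rw [ae_iff]
      simpa using h.noAtoms c
    filter_upwards [hne] with q hq
    rcases lt_or_gt_of_ne hq with hlt | hgt
    · have : (fun x => (Set.Ici x).indicator g q) =ᶠ[nhds c] fun _ => 0 := by
        filter_upwards [lt_mem_nhds hlt] with x hx
        exact Set.indicator_of_notMem (by simpa using hx) g
      exact continuousAt_const.congr this.symm
    · have : (fun x => (Set.Ici x).indicator g q) =ᶠ[nhds c] fun _ => g q := by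
        filter_upwards [gt_mem_nhds hgt] with x hx
        exact Set.indicator_of_mem (by simpa using hx.le) g
      exact continuousAt_const.congr this.symm

lemma Setting.integral_voteProb_cutoffRule (h : Setting K M p F) (c l : ℝ)
    (g : ℝ → ℝ) : ∫ q, voteProb (cutoffRule p c l) q * g q ∂F = tail F g c := by
  refine integral_congr_ae ?_
  filter_upwards [h.ae_voteProb_cutoffRule c l] with q hq
  rw [hq]
  rfl

lemma Setting.integral_voteProb_cutoffRule_eq_tail (h : Setting K M p F) (c l : ℝ) :
    ∫ q, voteProb (cutoffRule p c l) q ∂F = tail F (fun _ => 1) c := by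
  rw [← h.integral_voteProb_cutoffRule c l]
  simp

variable [IsProbabilityMeasure F]

lemma integral_rule_eq (h : Setting K M p F) {d : ℝ → Kind → ℝ} (hd : IsRule K M .nonExpert d) :
    ∫ q, d q .expert ∂F + ∫ q, d q .nonExpert ∂F = 1 - ∫ q, voteProb d q ∂F := by
  have h1 : ∀ q, voteProb d q = 1 - (d q .expert + d q .nonExpert) := fun q => by
    simp only [voteProb]; ring
  simp only [h1]
  have i1 : Integrable (fun q => d q .expert) F := h.integrable_rule (k := .nonExpert) hd _
  have i2 : Integrable (fun q => d q .nonExpert) F := h.integrable_rule (k := .nonExpert) hd _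
  have h2 := (integral_sub (integrable_const (1 : ℝ)) (i1.add i2)).trans
    (congrArg₂ (· - ·) rfl (integral_add i1 i2))
  simp only [Pi.add_apply, integral_const, probReal_univ, smul_eq_mul, mul_one] at h2
  linarith

lemma Setting.integral_cutoffRule (h : Setting K M p F) (c : ℝ) {l : ℝ}
    (hl : l ∈ Set.Icc (0 : ℝ) 1) :
    ∫ q, cutoffRule p c l q .expert ∂F = l * (1 - tail F (fun _ => 1) c) ∧
      ∫ q, cutoffRule p c l q .nonExpert ∂F = (1 - l) * (1 - tail F (fun _ => 1) c) := by
  have i0 : Integrable (voteProb (cutoffRule p c l)) F :=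
    h.integrable_voteProb (k := .nonExpert) (isRule_cutoffRule h hl)
  have h1 : ∀ q, cutoffRule p c l q .expert = l * (1 - voteProb (cutoffRule p c l) q) := by
    intro q
    rw [voteProb_cutoffRule]
    simp only [cutoffRule]
    split_ifs <;> ring
  have h2 : ∀ q, cutoffRule p c l q .nonExpert =
      (1 - l) * (1 - voteProb (cutoffRule p c l) q) := by
    intro q
    rw [voteProb_cutoffRule]
    simp only [cutoffRule]
    split_ifs <;> ring
  simp only [h1, h2, integral_const_mul]
  rw [integral_sub (integrable_const _) i0, h.integral_voteProb_cutoffRule_eq_tail]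
  simp

/-- The largest share of right votes, for a given frequency of voting, comes from a cutoff. -/
lemma Setting.integral_voteProb_mul_le (h : Setting K M p F) {d : ℝ → Kind → ℝ}
    (hd : IsRule K M .nonExpert d) {c : ℝ}
    (hc : tail F (fun _ => 1) c = ∫ q, voteProb d q ∂F) :
    ∫ q, voteProb d q * q ∂F ≤ tail F (fun q => q) c := by
  have iq : Integrable (fun q : ℝ => q) F :=
    h.integrable_of_bounded .nonExpert measurable_id 1 fun q hq => by
      rw [abs_le]
      constructor <;> linarith [hq.1, hq.2, h.lt_one]
  have i1 : Integrable (fun q => voteProb d q * q) F := by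
    have := h.integrable_voteProb_mul (k := .nonExpert) hd true
    simp only [if_true] at this
    exact this
  have i2 : Integrable (voteProb d) F := h.integrable_voteProb (k := .nonExpert) hd
  have i3 := iq.indicator (measurableSet_Ici (a := c))
  have i4 := (integrable_const (μ := F) (1 : ℝ)).indicator (measurableSet_Ici (a := c))
  -- The cutoff rule votes more often than `d` above `c` and less often below, so that the integrand,
  -- the product of this difference and `q - c`, is nonnegative.
  have h1 : 0 ≤ ∫ q, (((Set.Ici c).indicator (fun q => q) q - voteProb d q * q) -
      c * ((Set.Ici c).indicator (fun _ => (1 : ℝ)) q - voteProb d q)) ∂F := by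
    refine integral_nonneg fun q => ?_
    have hv0 := hd.voteProb_nonneg q
    have hv1 := hd.voteProb_le_one q
    by_cases hcq : c ≤ q
    · simp only [Set.indicator_of_mem (show q ∈ Set.Ici c from hcq), Pi.zero_apply]
      nlinarith
    · simp only [Set.indicator_of_notMem (show q ∉ Set.Ici c from hcq), Pi.zero_apply]
      nlinarith [not_le.1 hcq]
  have h2 := (integral_sub (i3.sub i1) ((i4.sub i2).const_mul c)).trans
    (congrArg₂ (· - ·) (integral_sub i3 i1)
      ((integral_const_mul _ _).trans (congrArg (c * ·) (integral_sub i4 i2))))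
  have h1 := h1.trans_eq h2
  change 0 ≤ tail F (fun q => q) c - _ - c * (tail F (fun _ => 1) c - _) at h1
  rw [hc, sub_self, mul_zero, sub_zero] at h1
  linarith

/-! ### Existence of an optimal pair of rules -/

/-- The action probabilities under the parameters `θ`. -/
noncomputable def paramVector (p : ℝ) (F : Measure ℝ) (θ : ℝ × ℝ × ℝ × ℝ) : Kind → Action → ℝ
  | .expert, .vote d => (1 - θ.1 - θ.2.1) * if d then p else 1 - p
  | .expert, .delegate .expert => θ.1
  | .expert, .delegate .nonExpert => θ.2.1
  | .nonExpert, .vote d => tail F (fun q => if d then q else 1 - q) θ.2.2.1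
  | .nonExpert, .delegate .expert => θ.2.2.2 * (1 - tail F (fun _ => 1) θ.2.2.1)
  | .nonExpert, .delegate .nonExpert => (1 - θ.2.2.2) * (1 - tail F (fun _ => 1) θ.2.2.1)

lemma Setting.ruleVector_paramRules (h : Setting K M p F) {θ : ℝ × ℝ × ℝ × ℝ}
    (hθ : θ ∈ paramSet K M p) (k : Kind) :
    ruleVector (precisionLaw p F k) (paramRules p θ k) = paramVector p F θ k := by
  obtain ⟨⟨h1, h2, h3, h4⟩, h5, h6⟩ := hθ
  funext x
  cases k
  · cases x with
    | vote d =>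
      change ∫ q, _ ∂Measure.dirac p = _
      rw [integral_dirac]
      rfl
    | delegate j =>
      change ∫ q, _ ∂Measure.dirac p = _
      rw [integral_dirac]
      cases j <;> rfl
  · cases x with
    | vote d => exact h.integral_voteProb_cutoffRule _ _ _
    | delegate j =>
      cases j
      · exact (h.integral_cutoffRule _ h4).1
      · exact (h.integral_cutoffRule _ h4).2

lemma Setting.continuous_paramVector (h : Setting K M p F) (k : Kind) (x : Action) :
    Continuous fun θ => paramVector p F θ k x := by
  have hg : ∀ d : Bool, Integrable (fun q : ℝ => if d then q else 1 - q) F := fun d =>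
    h.integrable_of_bounded .nonExpert (by split_ifs <;> fun_prop) 1 fun q hq => by
      rw [abs_le]
      split_ifs <;> constructor <;> linarith [hq.1, hq.2, h.lt_one]
  have ht := h.continuous_tail (integrable_const (1 : ℝ))
  cases k
  · rcases x with d | (_ | _) <;> simp only [paramVector] <;> fun_prop
  · rcases x with d | (_ | _) <;> simp only [paramVector]
    · exact (h.continuous_tail (hg d)).comp (by fun_prop)
    · fun_prop
    · fun_prop

/-- The sum over the two categories of the probabilities of voting. -/
noncomputable def totalVoteProb (p : ℝ) (F : Measure ℝ) (D : Kind → ℝ → Kind → ℝ) : ℝ :=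
  ∑ k, ∫ q, voteProb (D k) q ∂precisionLaw p F k

/-- Every pair of rules can be replaced, without loss and at the same frequencies of voting, by a
cutoff rule for the non-experts and a constant rule for the experts. -/
lemma Setting.exists_paramRules_ge (h : Setting K M p F) {D : Kind → ℝ → Kind → ℝ}
    (hD : ∀ k, IsRule K M k (D k)) :
    ∃ θ ∈ paramSet K M p, ruleValue K M p F D ≤ ruleValue K M p F (paramRules p θ) ∧
      totalVoteProb p F D = totalVoteProb p F (paramRules p θ) := by
  set d := D .nonExpert with hd
  have hdr : IsRule K M .nonExpert d := hD .nonExpert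
  have i2 : Integrable (voteProb d) F := h.integrable_voteProb (k := .nonExpert) hdr
  set T := ∫ q, voteProb d q ∂F with hT
  have hT0 : 0 ≤ T := integral_nonneg fun q => hdr.voteProb_nonneg q
  have hT1 : T ≤ 1 := by
    have := integral_mono i2 (integrable_const (1 : ℝ)) fun q => hdr.voteProb_le_one q
    simpa using this
  -- The cutoff `c` keeps the frequency of voting, the share `l` that of each delegation.
  obtain ⟨c, hc, hcT⟩ : ∃ c ∈ Set.Icc (1 / 2) p, tail F (fun _ => 1) c = T := by
    have := intermediate_value_Icc' h.half_lt.le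
      (h.continuous_tail (integrable_const (1 : ℝ))).continuousOn
    refine this ⟨?_, ?_⟩
    · rw [h.tail_top]; exact hT0
    · rw [h.tail_half]; simpa using hT1
  have hsum := integral_rule_eq h hdr
  have he0 : 0 ≤ ∫ q, d q .expert ∂F := integral_nonneg fun q => hdr.nonneg q _
  have hn0 : 0 ≤ ∫ q, d q .nonExpert ∂F := integral_nonneg fun q => hdr.nonneg q _
  obtain ⟨l, hl, hl1, hl2⟩ : ∃ l ∈ Set.Icc (0 : ℝ) 1, l * (1 - T) = ∫ q, d q .expert ∂F ∧
      (1 - l) * (1 - T) = ∫ q, d q .nonExpert ∂F := by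
    by_cases hT' : 1 - T = 0
    · exact ⟨0, by simp, by rw [hT']; linarith, by rw [hT']; linarith⟩
    · have hpos : 0 < 1 - T := lt_of_le_of_ne (by linarith) (Ne.symm hT')
      refine ⟨(∫ q, d q .expert ∂F) / (1 - T), ⟨by positivity, ?_⟩, by field_simp, ?_⟩
      · rw [div_le_one hpos]; linarith
      · field_simp; linarith
  have hE := hD .expert
  set θ : ℝ × ℝ × ℝ × ℝ := (D .expert p .expert, D .expert p .nonExpert, c, l) with hθ
  have hθm : θ ∈ paramSet K M p :=
    ⟨⟨⟨hE.nonneg p _, hE.le_one p _⟩, ⟨hE.nonneg p _, hE.le_one p _⟩, hc, hl⟩,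
      hE.sum_le_one p, fun h' => hE.available _ h' p⟩
  refine ⟨θ, hθm, ?_, ?_⟩
  · refine payoff_le_of_forall_update true fun w u hu => ?_
    have hu0 : ∀ w x, 0 ≤ u w x := by
      intro w x
      rcases hu w with hw | hw <;> rw [hw]
      · exact h.ruleVector_nonneg (hD _) x
      · exact h.ruleVector_nonneg (h.isRule_paramRules hθm _) x
    rw [h.ruleVector_paramRules hθm]
    cases hk : kind w
    · refine le_of_eq ?_
      congr 2
      funext x
      rcases x with e | (_ | _)
      · change ∫ q, _ ∂Measure.dirac p = _
        rw [integral_dirac]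
        rfl
      · change ∫ q, _ ∂Measure.dirac p = _
        rw [integral_dirac]
        rfl
      · change ∫ q, _ ∂Measure.dirac p = _
        rw [integral_dirac]
        rfl
    · refine payoff_update_le_of_vote_le hu0 w ?_ ?_ ?_
      · intro j
        cases j
        · simp only [paramVector, hθ, hcT, hl1]
          rfl
        · simp only [paramVector, hθ, hcT, hl2]
          rfl
      · rw [h.ruleVector_vote_add (hD _), ← h.ruleVector_paramRules hθm,
          h.ruleVector_vote_add (h.isRule_paramRules hθm _)]
        exact (hcT.symm.trans (h.integral_voteProb_cutoffRule_eq_tail c l).symm)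
      · have := h.integral_voteProb_mul_le hdr hcT
        change ∫ q, voteProb d q * (if true = true then q else 1 - q) ∂F ≤
          tail F (fun q => if true = true then q else 1 - q) c
        simpa only [if_true] using this
  · simp only [totalVoteProb, sum_kind]
    congr 1
    · change ∫ q, _ ∂Measure.dirac p = ∫ q, _ ∂Measure.dirac p
      rw [integral_dirac, integral_dirac]
      rfl
    · exact (hcT.symm.trans (h.integral_voteProb_cutoffRule_eq_tail c l).symm)

/-- There is an optimal pair of rules which moreover, among all optimal pairs, has the highest
frequency of voting. -/
lemma Setting.exists_isOptimal (h : Setting K M p F) :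
    ∃ θ ∈ paramSet K M p, IsOptimal K M p F (paramRules p θ) ∧
      ∀ D : Kind → ℝ → Kind → ℝ, (∀ k, IsRule K M k (D k)) →
        ruleValue K M p F (paramRules p θ) ≤ ruleValue K M p F D →
        totalVoteProb p F D ≤ totalVoteProb p F (paramRules p θ) := by
  set V : ℝ × ℝ × ℝ × ℝ → ℝ := fun θ =>
    payoff true fun v : Voter K M => paramVector p F θ (kind v) with hV
  have hVeq : ∀ θ ∈ paramSet K M p, ruleValue K M p F (paramRules p θ) = V θ := by
    intro θ hθ
    simp only [ruleValue, hV, h.ruleVector_paramRules hθ]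
  have hVc : Continuous V := by
    simp only [hV, payoff_apply]
    exact continuous_finsetSum _ fun a _ => (continuous_finsetProd _ fun v _ =>
      h.continuous_paramVector _ _).mul continuous_const
  set W : ℝ × ℝ × ℝ × ℝ → ℝ := fun θ =>
    (1 - θ.1 - θ.2.1) + tail F (fun _ => 1) θ.2.2.1 with hW
  have hWeq : ∀ θ ∈ paramSet K M p, totalVoteProb p F (paramRules p θ) = W θ := by
    intro θ hθ
    simp only [totalVoteProb, sum_kind, hW]
    congr 1
    · change ∫ q, _ ∂Measure.dirac p = _
      rw [integral_dirac]
      rfl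
    · exact h.integral_voteProb_cutoffRule_eq_tail _ _
  have hWc : Continuous W := by
    have := h.continuous_tail (integrable_const (1 : ℝ))
    fun_prop
  have hne : (paramSet K M p).Nonempty :=
    ⟨(0, 0, p, 0), ⟨by simp, by simp, by simpa using h.half_lt.le, by simp⟩, by simp, by simp⟩
  obtain ⟨θ₁, hθ₁, hmax₁⟩ :=
    (isCompact_paramSet K M p).exists_isMaxOn hne hVc.continuousOn
  have hcomp : IsCompact (paramSet K M p ∩ {θ | V θ₁ ≤ V θ}) :=
    (isCompact_paramSet K M p).inter_right (isClosed_le continuous_const hVc)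
  obtain ⟨θ, hθ, hmax⟩ := hcomp.exists_isMaxOn ⟨θ₁, hθ₁, le_refl (V θ₁)⟩ hWc.continuousOn
  refine ⟨θ, hθ.1, fun D hD => ?_, fun D hD hle => ?_⟩
  · obtain ⟨θ', hθ', h1, -⟩ := h.exists_paramRules_ge hD
    rw [hVeq θ hθ.1]
    rw [hVeq θ' hθ'] at h1
    exact h1.trans ((hmax₁ hθ').trans hθ.2)
  · obtain ⟨θ', hθ', h1, h2⟩ := h.exists_paramRules_ge hD
    rw [h2, hWeq θ hθ.1, hWeq θ' hθ']
    refine hmax ⟨hθ', ?_⟩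
    have h3 : V θ₁ ≤ V θ := hθ.2
    rw [hVeq θ hθ.1] at hle
    rw [hVeq θ' hθ'] at h1
    exact h3.trans (hle.trans h1)

end Setting

/-! ### Optimal rules form a Perfect Bayesian equilibrium -/

/-- Continuous functions that agree almost everywhere on an interval of possible precisions agree
on its closure. -/
lemma Setting.eqOn_of_ae {p : ℝ} {F : Measure ℝ} (h : Setting K M p F) {a b : ℝ}
    (ha : 1 / 2 ≤ a) (hab : a < b) (hb : b ≤ p) {f g : ℝ → ℝ} (hf : Continuous f)
    (hg : Continuous g) (hfg : ∀ᵐ q ∂F, q ∈ Set.Ioo a b → f q = g q) : Set.EqOn f g (Set.Icc a b) := by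
  have h1 : Set.EqOn f g (Set.Ioo a b) := by
    intro q hq
    by_contra hne
    have hmem : q ∈ F.support := by
      rw [h.support]
      exact ⟨ha.trans hq.1.le, hq.2.le.trans hb⟩
    have hU : {x | x ∈ Set.Ioo a b ∧ f x ≠ g x} ∈ nhds q :=
      (isOpen_Ioo.inter (isOpen_ne_fun hf hg)).mem_nhds ⟨hq, hne⟩
    have hpos := (Measure.mem_support_iff_forall q).1 hmem _ hU
    rw [ae_iff] at hfg
    refine hpos.ne' (le_antisymm (le_trans (measure_mono ?_) hfg.le) zero_le)
    intro x hx
    simpa [and_assoc] using hx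
  have h2 := h1.closure hf hg
  rwa [closure_Ioo hab.ne] at h2

section Bayesian

variable {p : ℝ} {F : Measure ℝ} [IsProbabilityMeasure F]

lemma isBehaviour_pure (x : Action) : IsBehaviour fun _ _ => Pi.single x 1 where
  nonneg q σ y := by
    by_cases h : y = x
    · subst h; simp
    · simp [Pi.single_eq_of_ne h]
  sum_eq_one q σ := by simp
  measurable σ y := measurable_const

lemma moments_pure (k : Kind) (ω : Bool) (x : Action) :
    moments (precisionLaw p F k) ω (fun _ _ => Pi.single x 1) = Pi.single x 1 := by
  funext y
  unfold moments
  simp only [← Finset.sum_mul, sum_signalProb, one_mul]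
  simp

/-- The interim payoff when the profile of the others treats the two states alike. -/
lemma Setting.interimUtility_eq (h : Setting K M p F) {r : Profile K M}
    (hr : ∀ w x, profileMoments p F r false w x = profileMoments p F r true w (flipAction x))
    (v : Voter K M) (q : ℝ) (σ : Bool) (x : Action) :
    interimUtility (1 / 2) p F r v q σ x =
      signalProb q true σ * payoff true
        (Function.update (profileMoments p F r true) v (Pi.single x 1)) +
      signalProb q false σ * payoff true
        (Function.update (profileMoments p F r true) v (Pi.single (flipAction x) 1)) := by
  have hbeh : ∀ w, IsBehaviour
      (Function.update (behaviour r) v (fun _ _ => Pi.single x 1) w) := by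
    intro w
    by_cases hw : w = v
    · subst hw
      rw [Function.update_self]
      exact isBehaviour_pure x
    · rw [Function.update_of_ne hw]
      exact (r w).isBehaviour
  have hstate : ∀ ω, stateValue p F (Function.update (behaviour r) v fun _ _ => Pi.single x 1) ω =
      payoff ω (Function.update (profileMoments p F r ω) v (Pi.single x 1)) := by
    intro ω
    rw [h.stateValue_eq hbeh]
    congr 1
    funext w
    by_cases hw : w = v
    · subst hw
      rw [Function.update_self, Function.update_self, moments_pure]
    · rw [Function.update_of_ne hw, Function.update_of_ne hw]
      rfl
  have hfalse : payoff false (Function.update (profileMoments p F r false) v (Pi.single x 1)) =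
      payoff true (Function.update (profileMoments p F r true) v
        (Pi.single (flipAction x) 1)) := by
    have hf : profileMoments p F r false =
        fun w x => profileMoments p F r true w (flipAction x) := by
      funext w x
      exact hr w x
    rw [hf, payoff_flip_update]
    congr 2
    funext y
    simp only [Pi.single_apply]
    congr 1
    exact propext ⟨fun h => by rw [← h, flipAction_flipAction],
      fun h => by rw [h, flipAction_flipAction]⟩
  have hsum : ∑ ω, prior (1 / 2) ω * signalProb q ω σ = 1 / 2 := by
    cases σ <;> simp [prior, signalProb] <;> ring
  have hpost : ∀ ω, posterior (1 / 2) q σ ω = signalProb q ω σ := by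
    intro ω
    unfold posterior
    rw [hsum]
    cases ω <;> simp only [prior, if_true, Bool.false_eq_true, if_false] <;> ring
  unfold interimUtility
  simp only [hstate, hpost, Fintype.sum_bool, hfalse]

/-- The payoff of a voter who follows a rule, as an average over her precision. -/
lemma Setting.sum_ruleVector_mul (h : Setting K M p F) {k : Kind} {d : ℝ → Kind → ℝ}
    (hd : IsRule K M k d) (f : Action → ℝ) :
    ∑ x, ruleVector (precisionLaw p F k) d x * f x =
      ∫ q, (voteProb d q * (q * f (.vote true) + (1 - q) * f (.vote false)) +
        d q .expert * f (.delegate .expert) + d q .nonExpert * f (.delegate .nonExpert))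
        ∂precisionLaw p F k := by
  have i1 := (h.integrable_voteProb_mul (k := k) hd true).mul_const (f (.vote true))
  have i2 := (h.integrable_voteProb_mul (k := k) hd false).mul_const (f (.vote false))
  have i3 := (h.integrable_rule (k := k) hd .expert).mul_const (f (.delegate .expert))
  have i4 := (h.integrable_rule (k := k) hd .nonExpert).mul_const (f (.delegate .nonExpert))
  rw [sum_action]
  simp only [ruleVector]
  rw [← integral_mul_const, ← integral_mul_const, ← integral_mul_const, ← integral_mul_const]
  refine ((congrArg₂ (· + ·) (congrArg₂ (· + ·) (integral_add i1 i2) rfl) rfl).symm.trans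
    ((congrArg₂ (· + ·) (integral_add (i1.add i2) i3) rfl).symm.trans
      (integral_add ((i1.add i2).add i3) i4).symm)).trans ?_
  congr 1
  funext q
  simp only [Pi.add_apply, if_true, Bool.false_eq_true, if_false]
  ring

/-- Optimality of an optimal pair of rules against arbitrary rules of a single voter. -/
lemma Setting.sum_ruleVector_mul_le (h : Setting K M p F) {D : Kind → ℝ → Kind → ℝ}
    (hD : ∀ k, IsRule K M k (D k)) (hopt : IsOptimal K M p F D) (v : Voter K M)
    {d : ℝ → Kind → ℝ} (hd : IsRule K M (kind v) d) :
    ∑ x, ruleVector (precisionLaw p F (kind v)) d x * payoff true (Function.update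
        (fun w : Voter K M => ruleVector (precisionLaw p F (kind w)) (D (kind w))) v
        (Pi.single x 1)) ≤
      ∑ x, ruleVector (precisionLaw p F (kind v)) (D (kind v)) x * payoff true (Function.update
        (fun w : Voter K M => ruleVector (precisionLaw p F (kind w)) (D (kind w))) v
        (Pi.single x 1)) := by
  rw [← payoff_update, ← payoff_update]
  refine (h.payoff_update_le_of_isOptimal hD hopt v hd).trans_eq ?_
  unfold ruleValue
  congr 1
  exact (Function.update_eq_self v _).symm

/-- Under optimal rules, each expert plays best responses. -/
lemma Setting.expert_best (h : Setting K M p F) {θ : ℝ × ℝ × ℝ × ℝ} (hθ : θ ∈ paramSet K M p)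
    (hopt : IsOptimal K M p F (paramRules p θ)) (v : Voter K M) (hv : kind v = .expert)
    (f : Action → ℝ)
    (hf : ∀ x, f x = payoff true (Function.update (fun w : Voter K M =>
      ruleVector (precisionLaw p F (kind w)) (paramRules p θ (kind w))) v (Pi.single x 1))) :
    ∃ m, p * f (.vote true) + (1 - p) * f (.vote false) ≤ m ∧
      (∀ j, CanDelegate K M .expert j → f (.delegate j) ≤ m) ∧
      (0 < 1 - θ.1 - θ.2.1 → p * f (.vote true) + (1 - p) * f (.vote false) = m) ∧
      (∀ j, 0 < constRule θ.1 θ.2.1 p j → f (.delegate j) = m) := by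
  have hD := h.isRule_paramRules hθ
  obtain ⟨⟨h1, h2, h3, h4⟩, h5, h6⟩ := hθ
  have hle : ∀ a b : ℝ, 0 ≤ a → 0 ≤ b → a + b ≤ 1 →
      (¬ CanDelegate K M .expert .expert → a = 0) →
      (1 - a - b) * (p * f (.vote true) + (1 - p) * f (.vote false)) +
        a * f (.delegate .expert) + b * f (.delegate .nonExpert) ≤
      (1 - θ.1 - θ.2.1) * (p * f (.vote true) + (1 - p) * f (.vote false)) +
        θ.1 * f (.delegate .expert) + θ.2.1 * f (.delegate .nonExpert) := by
    intro a b ha hb hab h0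
    have hd : IsRule K M (kind v) (constRule a b) := by
      rw [hv]
      exact isRule_constRule h ha hb hab h0
    have := h.sum_ruleVector_mul_le hD hopt v hd
    simp only [← hf] at this
    rw [h.sum_ruleVector_mul hd, h.sum_ruleVector_mul (hD (kind v)), hv] at this
    change ∫ q, _ ∂Measure.dirac p ≤ ∫ q, _ ∂Measure.dirac p at this
    rw [integral_dirac, integral_dirac] at this
    exact this
  set V := p * f (.vote true) + (1 - p) * f (.vote false) with hV
  set m := (1 - θ.1 - θ.2.1) * V + θ.1 * f (.delegate .expert) + θ.2.1 * f (.delegate .nonExpert)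
    with hm
  have e1 : V ≤ m := by
    have := hle 0 0 le_rfl le_rfl (by norm_num) fun _ => rfl
    linarith
  have e2 : f (.delegate .nonExpert) ≤ m := by
    have := hle 0 1 le_rfl zero_le_one (by norm_num) fun _ => rfl
    linarith
  have e3 : CanDelegate K M .expert .expert → f (.delegate .expert) ≤ m := by
    intro hc
    have := hle 1 0 zero_le_one le_rfl (by norm_num) fun h' => absurd hc h'
    linarith
  have t1 : 0 ≤ (1 - θ.1 - θ.2.1) * (m - V) := mul_nonneg (by linarith) (by linarith)
  have t2 : 0 ≤ θ.2.1 * (m - f (.delegate .nonExpert)) := mul_nonneg h2.1 (by linarith)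
  have t3 : 0 ≤ θ.1 * (m - f (.delegate .expert)) := by
    by_cases hc : CanDelegate K M .expert .expert
    · exact mul_nonneg h1.1 (by linarith [e3 hc])
    · rw [h6 hc, zero_mul]
  have hsum : (1 - θ.1 - θ.2.1) * (m - V) + θ.2.1 * (m - f (.delegate .nonExpert)) +
      θ.1 * (m - f (.delegate .expert)) = 0 := by
    have : (1 - θ.1 - θ.2.1) * (m - V) + θ.2.1 * (m - f (.delegate .nonExpert)) +
      θ.1 * (m - f (.delegate .expert)) = m - ((1 - θ.1 - θ.2.1) * V +
        θ.1 * f (.delegate .expert) + θ.2.1 * f (.delegate .nonExpert)) := by ring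
    rw [this, ← hm, sub_self]
  refine ⟨m, e1, ?_, ?_, ?_⟩
  · intro j hj
    cases j
    · exact e3 hj
    · exact e2
  · intro hpos
    have : (1 - θ.1 - θ.2.1) * (m - V) = 0 := by linarith
    rcases mul_eq_zero.1 this with h' | h' <;> linarith
  · intro j hj
    cases j
    · have : θ.1 * (m - f (.delegate .expert)) = 0 := by linarith
      rcases mul_eq_zero.1 this with h' | h'
      · exact absurd h' hj.ne'
      · linarith
    · have : θ.2.1 * (m - f (.delegate .nonExpert)) = 0 := by linarith
      rcases mul_eq_zero.1 this with h' | h'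
      · exact absurd h' hj.ne'
      · linarith

/-- Under optimal rules, each non-expert plays best responses: voting is best from the cutoff on,
and delegation below it. -/
lemma Setting.nonExpert_best (h : Setting K M p F) {θ : ℝ × ℝ × ℝ × ℝ}
    (hθ : θ ∈ paramSet K M p) (hopt : IsOptimal K M p F (paramRules p θ)) (v : Voter K M)
    (hv : kind v = .nonExpert) (f : Action → ℝ)
    (hf : ∀ x, f x = payoff true (Function.update (fun w : Voter K M =>
      ruleVector (precisionLaw p F (kind w)) (paramRules p θ (kind w))) v (Pi.single x 1)))
    {q : ℝ} (hq : q ∈ Set.Icc (1 / 2) p) :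
    (θ.2.2.1 ≤ q ∧ θ.2.2.1 < p →
      ∀ j, f (.delegate j) ≤ q * f (.vote true) + (1 - q) * f (.vote false)) ∧
    (¬ (θ.2.2.1 ≤ q ∧ θ.2.2.1 < p) →
      q * f (.vote true) + (1 - q) * f (.vote false) ≤
        θ.2.2.2 * f (.delegate .expert) + (1 - θ.2.2.2) * f (.delegate .nonExpert) ∧
      ∀ j, f (.delegate j) ≤
        θ.2.2.2 * f (.delegate .expert) + (1 - θ.2.2.2) * f (.delegate .nonExpert)) := by
  have hD := h.isRule_paramRules hθ
  obtain ⟨⟨h1, h2, h3, h4⟩, h5, h6⟩ := hθ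
  obtain ⟨a, b, c, l⟩ := θ
  simp only at h1 h2 h3 h4 h5 h6 ⊢
  set V : ℝ → ℝ := fun q => q * f (.vote true) + (1 - q) * f (.vote false) with hV
  set B := max (f (.delegate .expert)) (f (.delegate .nonExpert)) with hB
  set m : ℝ → ℝ := fun q => max (V q) B with hm
  have hVc : Continuous V := by fun_prop
  have hmc : Continuous m := hVc.max continuous_const
  have hjB : ∀ j, f (.delegate j) ≤ B := by
    intro j
    cases j
    · exact le_max_left _ _
    · exact le_max_right _ _
  -- The payoff at precision `q` under the rule, and the rule that is optimal at each precision.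
  set u : ℝ → ℝ := fun q => voteProb (cutoffRule p c l) q * V q +
    cutoffRule p c l q .expert * f (.delegate .expert) +
    cutoffRule p c l q .nonExpert * f (.delegate .nonExpert) with hu
  obtain ⟨d, hdr, hdm⟩ : ∃ d, IsRule K M .nonExpert d ∧ ∀ q, voteProb d q * V q +
      d q .expert * f (.delegate .expert) + d q .nonExpert * f (.delegate .nonExpert) = m q := by
    obtain ⟨e, he, hej⟩ : ∃ e ∈ Set.Icc (0 : ℝ) 1,
        e * f (.delegate .expert) + (1 - e) * f (.delegate .nonExpert) = B := by
      rcases le_total (f (.delegate .expert)) (f (.delegate .nonExpert)) with hle | hle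
      · exact ⟨0, by simp, by rw [hB, max_eq_right hle]; ring⟩
      · exact ⟨1, by simp, by rw [hB, max_eq_left hle]; ring⟩
    have hmeas : MeasurableSet {q | V q < B} := measurableSet_lt hVc.measurable measurable_const
    refine ⟨fun q j => if V q < B then constRule e (1 - e) q j else 0,
      ⟨fun j => ?_, fun q j => ?_, fun q => ?_, fun j hj => ?_⟩, fun q => ?_⟩
    · cases j <;> exact Measurable.ite hmeas measurable_const measurable_const
    · cases j <;> simp only [constRule] <;> split_ifs <;> linarith [he.1, he.2]
    · simp only [constRule]
      split_ifs <;> linarith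
    · exact absurd (h.canDelegate (by simp)) hj
    · simp only [voteProb, constRule, hm]
      split_ifs with hlt
      · rw [max_eq_right hlt.le]
        linarith
      · rw [max_eq_left (not_lt.1 hlt)]
        ring
  have hum : ∀ q, u q ≤ m q := by
    intro q
    have hl0 := h4.1
    have hl1 := h4.2
    simp only [hu, hm, voteProb_cutoffRule, cutoffRule]
    split_ifs
    · simp
    · refine le_trans ?_ (le_max_right _ _)
      nlinarith [hjB .expert, hjB .nonExpert]
  -- Optimality gives `∫ m ≤ ∫ u`, while `u ≤ m`.
  have hae : ∀ᵐ q ∂F, m q = u q := by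
    have hdr' : IsRule K M (kind v) d := by rwa [hv]
    have h7 := h.sum_ruleVector_mul_le hD hopt v hdr'
    simp only [← hf] at h7
    rw [h.sum_ruleVector_mul hdr', h.sum_ruleVector_mul (hD (kind v)), hv] at h7
    change ∫ q, (voteProb d q * V q + d q .expert * f (.delegate .expert) +
      d q .nonExpert * f (.delegate .nonExpert)) ∂F ≤ ∫ q, u q ∂F at h7
    simp only [hdm] at h7
    have hint : ∀ g : ℝ → Kind → ℝ, IsRule K M .nonExpert g → Integrable (fun q =>
        voteProb g q * V q + g q .expert * f (.delegate .expert) +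
        g q .nonExpert * f (.delegate .nonExpert)) F := by
      intro g hg
      have i1 := (h.integrable_voteProb_mul (k := .nonExpert) hg true).mul_const (f (.vote true))
      have i2 := (h.integrable_voteProb_mul (k := .nonExpert) hg false).mul_const
        (f (.vote false))
      have i3 := (h.integrable_rule (k := .nonExpert) hg .expert).mul_const
        (f (.delegate .expert))
      have i4 := (h.integrable_rule (k := .nonExpert) hg .nonExpert).mul_const
        (f (.delegate .nonExpert))
      refine (((i1.add i2).add i3).add i4).congr (Filter.Eventually.of_forall fun q => ?_)
      simp only [Pi.add_apply, if_true, Bool.false_eq_true, if_false, hV]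
      ring
    have im : Integrable m F := by
      have := hint d hdr
      simpa only [hdm] using this
    have iu : Integrable u F := hint _ (hD .nonExpert)
    have h8 : ∫ q, (m - u) q ∂F = 0 := by
      refine le_antisymm ?_ (integral_nonneg fun q => sub_nonneg.2 (hum q))
      rw [integral_sub' im iu]
      linarith
    have h9 := (integral_eq_zero_iff_of_nonneg (fun q => sub_nonneg.2 (hum q))
      (im.sub iu)).1 h8
    filter_upwards [h9] with q hq
    exact sub_eq_zero.1 hq
  -- On either side of the cutoff both functions are continuous, so that they agree up to the
  -- endpoints.
  refine ⟨fun hcq j => ?_, fun hcq => ?_⟩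
  · have heq : Set.EqOn m V (Set.Icc c p) := by
      refine h.eqOn_of_ae h3.1 hcq.2 le_rfl hmc hVc ?_
      filter_upwards [hae] with x hx hxI
      rw [hx]
      simp only [hu, voteProb_cutoffRule, cutoffRule, if_pos (And.intro hxI.1.le hcq.2)]
      ring
    have := heq ⟨hcq.1, hq.2⟩
    exact (hjB j).trans ((le_max_right _ _).trans_eq this)
  · have hqc : q ≤ c := by
      by_contra! hlt
      exact hcq ⟨hlt.le, hlt.trans_le hq.2⟩
    have hc : 1 / 2 < c := by
      rcases hqc.lt_or_eq with hlt | heq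
      · exact hq.1.trans_lt hlt
      · have : ¬ c < p := fun h' => hcq ⟨heq.ge, h'⟩
        exact h.half_lt.trans_le (not_lt.1 this)
    have heq : Set.EqOn m (fun _ => l * f (.delegate .expert) + (1 - l) * f (.delegate .nonExpert))
        (Set.Icc (1 / 2) c) := by
      refine h.eqOn_of_ae le_rfl hc h3.2 hmc continuous_const ?_
      filter_upwards [hae] with x hx hxI
      rw [hx]
      have hn : ¬ (c ≤ x ∧ c < p) := fun h' => absurd h'.1 (not_le.2 hxI.2)
      simp only [hu, voteProb_cutoffRule, cutoffRule, if_neg hn]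
      ring
    have := heq ⟨hq.1, hqc⟩
    exact ⟨(le_max_left _ _).trans_eq this,
      fun j => (hjB j).trans ((le_max_right _ _).trans_eq this)⟩

/-- An optimal pair of rules is a Perfect Bayesian equilibrium. -/
lemma Setting.isPerfectBayesian (h : Setting K M p F) {θ : ℝ × ℝ × ℝ × ℝ}
    (hθ : θ ∈ paramSet K M p) (hopt : IsOptimal K M p F (paramRules p θ)) :
    IsPerfectBayesian (1 / 2) p F (ruleProfile (fun v : Voter K M => paramRules p θ (kind v))
      fun v => h.isRule_paramRules hθ (kind v)) := by
  intro v q hq σ x y hx hy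
  set r := ruleProfile (fun v : Voter K M => paramRules p θ (kind v))
      fun v => h.isRule_paramRules hθ (kind v) with hr
  have hsym := profileMoments_ruleProfile_false p F
    (fun v : Voter K M => paramRules p θ (kind v)) fun v => h.isRule_paramRules hθ (kind v)
  rw [h.interimUtility_eq hsym, h.interimUtility_eq hsym, profileMoments_ruleProfile]
  obtain ⟨f, hf⟩ : ∃ f : Action → ℝ, ∀ x, f x = payoff true (Function.update (fun w : Voter K M =>
      ruleVector (precisionLaw p F (kind w)) (paramRules p θ (kind w))) v (Pi.single x 1)) :=
    ⟨_, fun _ => rfl⟩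
  simp only [← hf]
  have hmono : f (.vote false) ≤ f (.vote true) := by
    rw [hf, hf]
    exact payoff_vote_mono true v fun w _ => h.ruleVector_nonneg (h.isRule_paramRules hθ _)
  have hqI : q ∈ Set.Icc (1 / 2) p := by
    cases hk : kind v
    · rw [hk] at hq
      rw [show q = p from hq]
      exact ⟨h.half_lt.le, le_rfl⟩
    · rw [hk] at hq
      exact hq
  set V := q * f (.vote true) + (1 - q) * f (.vote false) with hV
  -- The interim payoffs of the actions.
  set g : Action → ℝ := fun x =>
    signalProb q true σ * f x + signalProb q false σ * f (flipAction x) with hg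
  have hgs : g (.vote σ) = V := by
    cases σ <;> simp [hg, hV, signalProb] <;> ring
  have hgn : g (.vote !σ) ≤ V := by
    cases σ <;> simp [hg, hV, signalProb] <;> nlinarith [hqI.1]
  have hgd : ∀ j, g (.delegate j) = f (.delegate j) := by
    intro j
    cases σ <;> simp [hg, signalProb, ← add_mul]
  change g y ≤ g x
  suffices hmain : ∃ m, V ≤ m ∧ (∀ j, Available v (.delegate j) → f (.delegate j) ≤ m) ∧
      (0 < voteProb (paramRules p θ (kind v)) q → V = m) ∧
      ∀ j, 0 < paramRules p θ (kind v) q j → f (.delegate j) = m by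
    obtain ⟨m, h1, h2, h3, h4⟩ := hmain
    have hxm : g x = m := by
      cases x with
      | vote c =>
        change 0 < (if c = σ then voteProb (paramRules p θ (kind v)) q else 0) at hx
        split_ifs at hx with hc
        · rw [hc, hgs]
          exact h3 hx
        · exact absurd hx (lt_irrefl 0)
      | delegate j =>
        rw [hgd]
        exact h4 j hx
    rw [hxm]
    cases y with
    | vote c =>
      by_cases hc : c = σ
      · rw [hc, hgs]
        exact h1
      · rw [show c = !σ by cases c <;> cases σ <;> simp_all]
        exact hgn.trans h1
    | delegate j =>
      rw [hgd]
      exact h2 j hy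
  cases hk : kind v
  · rw [hk] at hq
    have hqp : q = p := hq
    obtain ⟨m, h1, h2, h3, h4⟩ := h.expert_best hθ hopt v hk f hf
    rw [hqp] at hV
    rw [hV, hqp]
    refine ⟨m, h1, fun j hj => h2 j ?_, h3, h4⟩
    rw [← hk]
    exact (available_delegate_iff v j).1 hj
  · obtain ⟨h1, h2⟩ := h.nonExpert_best hθ hopt v hk f hf hqI
    by_cases hc : θ.2.2.1 ≤ q ∧ θ.2.2.1 < p
    · refine ⟨V, le_rfl, fun j _ => h1 hc j, fun _ => rfl, fun j hj => ?_⟩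
      exfalso
      cases j <;> simp [paramRules, cutoffRule, hc] at hj
    · obtain ⟨h3, h4⟩ := h2 hc
      refine ⟨_, h3, fun j _ => h4 j, fun hv => ?_, fun j hj => ?_⟩
      · change 0 < voteProb (cutoffRule p θ.2.2.1 θ.2.2.2) q at hv
        rw [voteProb_cutoffRule, if_neg hc] at hv
        exact absurd hv (lt_irrefl 0)
      · have h5 := h4 .expert
        have h6 := h4 .nonExpert
        refine le_antisymm (h4 j) ?_
        cases j
        · have hl : 0 < θ.2.2.2 := by simpa [paramRules, cutoffRule, hc] using hj
          nlinarith [hθ.1.2.2.2.2]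
        · have hl : 0 < 1 - θ.2.2.2 := by
            simpa only [paramRules, cutoffRule, if_neg hc] using hj
          nlinarith [hθ.1.2.2.2.1]

end Bayesian

/-! ### Sincere majority voting -/

/-- The rule of never delegating. -/
def alwaysVote (_ : ℝ) (_ : Kind) : ℝ := 0

lemma isRule_alwaysVote (k : Kind) : IsRule K M k alwaysVote where
  measurable _ := measurable_const
  nonneg _ _ := le_rfl
  sum_le_one _ := by simp [alwaysVote]
  available _ _ _ := rfl

lemma voteProb_alwaysVote (q : ℝ) : voteProb alwaysVote q = 1 := by
  simp [voteProb, alwaysVote]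

/-- The mean precision in a category. -/
noncomputable def meanPrecision (p : ℝ) (F : Measure ℝ) (k : Kind) : ℝ :=
  ∫ q, q ∂precisionLaw p F k

lemma meanPrecision_expert (p : ℝ) (F : Measure ℝ) : meanPrecision p F .expert = p :=
  integral_dirac (fun q => q) p

/-- For every voter there are two further voters. -/
lemma Setting.exists_two_others {p : ℝ} {F : Measure ℝ} (h : Setting K M p F) (v : Voter K M) :
    ∃ e u : Voter K M, e ≠ v ∧ u ≠ v ∧ e ≠ u := by
  have hK : 0 < K := h.odd_experts.pos
  have hM := h.two_le
  set x : Voter K M := Sum.inl ⟨0, hK⟩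
  set y : Voter K M := Sum.inr ⟨0, by omega⟩
  set w : Voter K M := Sum.inr ⟨1, by omega⟩
  have hxy : x ≠ y := by simp [x, y]
  have hxw : x ≠ w := by simp [x, w]
  have hyw : y ≠ w := by simp [y, w]
  by_cases h1 : v = x
  · exact ⟨y, w, h1 ▸ hxy.symm, h1 ▸ hxw.symm, hyw⟩
  · by_cases h2 : v = y
    · exact ⟨x, w, h2 ▸ hxy, h2 ▸ hyw.symm, hxw⟩
    · exact ⟨x, y, Ne.symm h1, Ne.symm h2, hxy⟩

section Majority

variable {p : ℝ} {F : Measure ℝ} [IsProbabilityMeasure F]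

lemma Setting.integrable_precision (h : Setting K M p F) (k : Kind) :
    Integrable (fun q : ℝ => q) (precisionLaw p F k) :=
  h.integrable_of_bounded k measurable_id 1 fun q hq => by
    rw [abs_le]
    constructor <;> linarith [hq.1, hq.2, h.lt_one]

lemma Setting.ruleVector_alwaysVote (h : Setting K M p F) (k : Kind) :
    ruleVector (precisionLaw p F k) alwaysVote = sincereVector (meanPrecision p F k) := by
  funext x
  rcases x with (_ | _) | j
  · simp only [ruleVector, voteProb_alwaysVote, one_mul, sincereVector, Bool.false_eq_true,
      if_false, meanPrecision]
    rw [integral_sub (integrable_const _) (h.integrable_precision k)]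
    simp
  · simp only [ruleVector, voteProb_alwaysVote, one_mul, sincereVector, if_true, meanPrecision]
  · simp [ruleVector, alwaysVote, sincereVector]

lemma Setting.meanPrecision_nonExpert (h : Setting K M p F) :
    0 < meanPrecision p F .nonExpert ∧ meanPrecision p F .nonExpert < p := by
  have iq : Integrable (fun q : ℝ => q) F := h.integrable_precision .nonExpert
  constructor
  · have h1 : (1 / 2 : ℝ) ≤ ∫ q, q ∂F := by
      have h2 := integral_mono_ae (integrable_const (1 / 2 : ℝ)) iq
        ((h.ae_mem .nonExpert).mono fun q hq => hq.1)
      simpa using h2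
    exact lt_of_lt_of_le (by norm_num) h1
  · have h0 : 0 ≤ ∫ q, (p - q) ∂F := integral_nonneg_of_ae <| by
      filter_upwards [h.ae_lt] with q hq
      simpa using hq.le
    have h1 : ∫ q, (p - q) ∂F = p - ∫ q, q ∂F := by
      rw [integral_sub (integrable_const _) iq]
      simp
    refine lt_of_le_of_ne (by change ∫ q, q ∂F ≤ p; linarith) fun heq => ?_
    change ∫ q, q ∂F = p at heq
    rw [heq, sub_self] at h1
    have h2 := (integral_eq_zero_iff_of_nonneg_ae (by
      filter_upwards [h.ae_lt] with q hq
      simpa using hq.le) ((integrable_const p).sub iq)).1 h1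
    obtain ⟨q, hq1, hq2⟩ := (h2.and h.ae_lt).exists
    simp only [Pi.sub_apply, Pi.zero_apply] at hq1
    linarith

lemma Setting.meanPrecision_pos (h : Setting K M p F) (k : Kind) : 0 < meanPrecision p F k := by
  cases k
  · rw [meanPrecision_expert]
    linarith [h.half_lt]
  · exact h.meanPrecision_nonExpert.1

lemma Setting.meanPrecision_lt_one (h : Setting K M p F) (k : Kind) :
    meanPrecision p F k < 1 := by
  cases k
  · rw [meanPrecision_expert]
    exact h.lt_one
  · exact h.meanPrecision_nonExpert.2.trans h.lt_one

lemma Setting.expectedUtility_ruleProfile (h : Setting K M p F) (D : Voter K M → ℝ → Kind → ℝ)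
    (hD : ∀ v, IsRule K M (kind v) (D v)) :
    expectedUtility (1 / 2) p F (ruleProfile D hD) =
      payoff true fun v => ruleVector (precisionLaw p F (kind v)) (D v) := by
  have h1 := h.expectedUtility_eq (ruleProfile D hD)
  have h2 : payoff false (profileMoments p F (ruleProfile D hD) false) =
      payoff true (profileMoments p F (ruleProfile D hD) true) := by
    rw [← payoff_flip true]
    congr 1
    funext w x
    exact profileMoments_ruleProfile_false p F D hD w x
  change _ = (payoff true (profileMoments p F (ruleProfile D hD) true) +
    payoff false (profileMoments p F (ruleProfile D hD) false)) / 2 at h1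
  rw [h1, h2, ← profileMoments_ruleProfile p F D hD]
  ring

lemma majority_eq_ite (hN : Odd (K + M)) (τ : Voter K M → Bool) (ω : Bool) :
    majority τ ω =
      if K + M < 2 * (Finset.univ.filter fun v => τ v = ω).card then 1 else 0 := by
  have h1 := Finset.card_filter_add_card_filter_not (s := (Finset.univ : Finset (Voter K M)))
    (fun v => τ v = ω)
  have h2 : (Finset.univ.filter fun v => ¬ τ v = ω) = Finset.univ.filter fun v => τ v = !ω := by
    refine Finset.filter_congr fun v _ => ?_
    cases τ v <;> cases ω <;> simp
  have h3 : (Finset.univ : Finset (Voter K M)).card = K + M := by simp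
  rw [h2, h3] at h1
  obtain ⟨m, hm⟩ := hN
  unfold majority
  split_ifs <;> first | omega | rfl

lemma Setting.majorityVotingUtility_eq (h : Setting K M p F) :
    majorityVotingUtility K M (1 / 2) p F =
      payoff true fun v : Voter K M => sincereVector (meanPrecision p F (kind v)) := by
  have h1 : majorityVotingUtility K M (1 / 2) p F = expectedUtility (1 / 2) p F
      (ruleProfile (fun _ : Voter K M => alwaysVote) fun v => isRule_alwaysVote (kind v)) := by
    unfold majorityVotingUtility expectedUtility stateValue
    refine Finset.sum_congr rfl fun ω _ => ?_
    congr 1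
    refine integral_congr_ae (Filter.Eventually.of_forall fun q => ?_)
    refine Finset.sum_congr rfl fun σ _ => ?_
    congr 1
    rw [← majority_eq_ite h.odd_total, ← decisionProb_vote]
    symm
    refine (Finset.sum_eq_single (fun v => Action.vote (σ v)) ?_ ?_).trans ?_
    · intro a _ ha
      obtain ⟨v, hv⟩ := Function.ne_iff.1 ha
      rw [Finset.prod_eq_zero (Finset.mem_univ v), zero_mul]
      change ruleProb alwaysVote (q v) (σ v) (a v) = 0
      cases hav : a v with
      | vote c =>
        have : c ≠ σ v := by
          rintro rfl
          exact hv hav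
        simp [ruleProb, this]
      | delegate j => rfl
    · exact fun h' => absurd (Finset.mem_univ _) h'
    · rw [Finset.prod_eq_one, one_mul]
      intro v _
      change ruleProb alwaysVote (q v) (σ v) (.vote (σ v)) = 1
      simp [ruleProb, voteProb_alwaysVote]
  rw [h1, h.expectedUtility_ruleProfile]
  simp only [h.ruleVector_alwaysVote]

/-- Never delegating is not optimal: non-experts of low precision should delegate to experts. -/
lemma Setting.not_isOptimal_of_sincere (h : Setting K M p F) {D : Kind → ℝ → Kind → ℝ}
    (hopt : IsOptimal K M p F D)
    (hval : ruleValue K M p F D ≤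
      payoff true fun v : Voter K M => sincereVector (meanPrecision p F (kind v))) : False := by
  set θ : ℝ × ℝ × ℝ × ℝ := (0, 0, 1 / 2, 0) with hθdef
  have hθ : θ ∈ paramSet K M p :=
    ⟨⟨by simp [hθdef], by simp [hθdef], by simpa [hθdef] using h.half_lt.le, by simp [hθdef]⟩,
      by simp [hθdef], by simp [hθdef]⟩
  have hvec : ∀ k, ruleVector (precisionLaw p F k) (paramRules p θ k) =
      sincereVector (meanPrecision p F k) := by
    intro k
    rw [← h.ruleVector_alwaysVote]
    cases k
    · have hrule : paramRules p θ .expert = alwaysVote := by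
        funext q j
        cases j <;> simp [paramRules, constRule, alwaysVote, hθdef]
      rw [hrule]
    · have hae : ∀ᵐ q ∂F, voteProb (cutoffRule p (1 / 2) 0) q = 1 ∧
          ∀ j, cutoffRule p (1 / 2) 0 q j = 0 := by
        filter_upwards [h.ae_mem .nonExpert] with q hq
        have : 1 / 2 ≤ q ∧ 1 / 2 < p := ⟨hq.1, h.half_lt⟩
        refine ⟨by rw [voteProb_cutoffRule, if_pos this], fun j => ?_⟩
        cases j <;> simp only [cutoffRule, if_pos this]
      funext x
      cases x with
      | vote c =>
        refine integral_congr_ae (hae.mono fun q hq => ?_)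
        change voteProb (cutoffRule p (1 / 2) 0) q * _ = voteProb alwaysVote q * _
        rw [hq.1, voteProb_alwaysVote]
      | delegate j => exact integral_congr_ae (hae.mono fun q hq => hq.2 j)
  have hopt' : IsOptimal K M p F (paramRules p θ) := by
    intro D' hD'
    refine (hopt D' hD').trans (hval.trans_eq ?_)
    simp only [ruleValue, hvec]
  have hM := h.two_le
  -- At precision `1 / 2`, voting amounts to a vote for a random decision.
  set v : Voter K M := Sum.inr ⟨0, by omega⟩ with hv
  have hne : ∀ j, (others v j).Nonempty := fun j =>
    (available_delegate_iff v j).2 (h.canDelegate (by simp [hv, kind]))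
  have hbest := (h.nonExpert_best hθ hopt' v rfl _ (fun _ => rfl)
    (q := 1 / 2) ⟨le_rfl, h.half_lt.le⟩).1 ⟨le_rfl, h.half_lt⟩ .expert
  simp only [hvec] at hbest
  have hgt := payoff_sincere_delegate_gt h.odd_total
    (r := fun w : Voter K M => meanPrecision p F (kind w)) (fun w => h.meanPrecision_pos _)
    (fun w => h.meanPrecision_lt_one _) (fun e u he hu => by
      rw [he, hu, meanPrecision_expert]
      exact h.meanPrecision_nonExpert.2) (hne .expert) (hne .nonExpert)
  linarith

end Majority

/-! ### Undominated strategies -/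

section Undominated

variable {p : ℝ} {F : Measure ℝ} [IsProbabilityMeasure F]

/-- A cutoff rule (and likewise a constant rule of experts, whose precision is fixed) has the
largest surplus of right over wrong votes among all rules that vote at most as often, and a rule
with the same surplus votes equally often. -/
lemma Setting.vote_sub_le_paramRules (h : Setting K M p F) {θ : ℝ × ℝ × ℝ × ℝ}
    (hθ : θ ∈ paramSet K M p) {k : Kind} {d : ℝ → Kind → ℝ} (hd : IsRule K M k d)
    (hle : ∫ q, voteProb d q ∂precisionLaw p F k ≤
      ∫ q, voteProb (paramRules p θ k) q ∂precisionLaw p F k) :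
    ∫ q, voteProb d q * (2 * q - 1) ∂precisionLaw p F k ≤
        ∫ q, voteProb (paramRules p θ k) q * (2 * q - 1) ∂precisionLaw p F k ∧
      (∫ q, voteProb d q * (2 * q - 1) ∂precisionLaw p F k =
        ∫ q, voteProb (paramRules p θ k) q * (2 * q - 1) ∂precisionLaw p F k →
        ∫ q, voteProb d q ∂precisionLaw p F k =
          ∫ q, voteProb (paramRules p θ k) q ∂precisionLaw p F k) := by
  have hp := h.half_lt
  have hD := h.isRule_paramRules hθ
  cases k
  · change ∫ q, _ ∂Measure.dirac p ≤ ∫ q, _ ∂Measure.dirac p at hle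
    change ∫ q, _ ∂Measure.dirac p ≤ ∫ q, _ ∂Measure.dirac p ∧
      (∫ q, _ ∂Measure.dirac p = ∫ q, _ ∂Measure.dirac p →
        ∫ q, _ ∂Measure.dirac p = ∫ q, _ ∂Measure.dirac p)
    simp only [integral_dirac] at hle ⊢
    have hpos : 0 < 2 * p - 1 := by linarith
    exact ⟨mul_le_mul_of_nonneg_right hle hpos.le, fun he => mul_right_cancel₀ hpos.ne' he⟩
  · obtain ⟨⟨-, -, h3, h4⟩, -⟩ := hθ
    obtain ⟨a, b, c, l⟩ := θ
    have hDr : IsRule K M .nonExpert (cutoffRule p c l) := hD .nonExpert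
    change ∫ q, voteProb d q ∂F ≤ ∫ q, voteProb (cutoffRule p c l) q ∂F at hle
    change ∫ q, voteProb d q * (2 * q - 1) ∂F ≤
        ∫ q, voteProb (cutoffRule p c l) q * (2 * q - 1) ∂F ∧
      (∫ q, voteProb d q * (2 * q - 1) ∂F =
        ∫ q, voteProb (cutoffRule p c l) q * (2 * q - 1) ∂F →
        ∫ q, voteProb d q ∂F = ∫ q, voteProb (cutoffRule p c l) q ∂F)
    simp only at h3 h4
    set ρ := voteProb (cutoffRule p c l) with hρ
    have i1 : Integrable (voteProb d) F := h.integrable_voteProb (k := .nonExpert) hd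
    have i2 : Integrable ρ F := h.integrable_voteProb (k := .nonExpert) hDr
    have hj : ∀ g : ℝ → Kind → ℝ, IsRule K M .nonExpert g →
        Integrable (fun q => voteProb g q * (2 * q - 1)) F := by
      intro g hg
      refine ((h.integrable_voteProb_mul (k := .nonExpert) hg true).sub
        (h.integrable_voteProb_mul (k := .nonExpert) hg false)).congr
        (Filter.Eventually.of_forall fun q => ?_)
      simp only [Pi.sub_apply, if_true, Bool.false_eq_true, if_false]
      ring
    have j1 := hj d hd
    have j2 := hj _ hDr
    -- The surplus is split into a nonnegative integral and a multiple of the difference of the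
    -- frequencies of voting.
    set w : ℝ → ℝ := fun q => (ρ q * (2 * q - 1) - voteProb d q * (2 * q - 1)) -
      (2 * c - 1) * (ρ q - voteProb d q) with hw
    have iw : Integrable w F := (j2.sub j1).sub ((i2.sub i1).const_mul _)
    have hwint : ∫ q, w q ∂F = (∫ q, ρ q * (2 * q - 1) ∂F - ∫ q, voteProb d q * (2 * q - 1) ∂F) -
        (2 * c - 1) * (∫ q, ρ q ∂F - ∫ q, voteProb d q ∂F) :=
      (integral_sub (j2.sub j1) ((i2.sub i1).const_mul _)).trans
        (congrArg₂ (· - ·) (integral_sub j2 j1)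
          ((integral_const_mul _ _).trans (congrArg ((2 * c - 1) * ·) (integral_sub i2 i1))))
    have hweq : ∀ᵐ q ∂F, w q = 2 * (q - c) * ((if c ≤ q then 1 else 0) - voteProb d q) ∧
        ρ q = if c ≤ q then 1 else 0 := by
      filter_upwards [h.ae_lt] with q hq
      have : ρ q = if c ≤ q then 1 else 0 := by
        rw [hρ, voteProb_cutoffRule]
        by_cases hcq : c ≤ q
        · rw [if_pos ⟨hcq, hcq.trans_lt hq⟩, if_pos hcq]
        · rw [if_neg fun h' => hcq h'.1, if_neg hcq]
      refine ⟨?_, this⟩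
      simp only [hw, this]
      ring
    have hw0 : 0 ≤ᵐ[F] w := by
      filter_upwards [hweq] with q hq
      rw [hq.1]
      have hv0 := hd.voteProb_nonneg q
      have hv1 := hd.voteProb_le_one q
      split_ifs with hcq
      · exact mul_nonneg (by linarith) (by linarith)
      · exact mul_nonneg_of_nonpos_of_nonpos (by linarith [not_le.1 hcq]) (by linarith)
    have hpos := integral_nonneg_of_ae hw0
    have hc : 0 ≤ 2 * c - 1 := by linarith [h3.1]
    have hmul : 0 ≤ (2 * c - 1) * (∫ q, ρ q ∂F - ∫ q, voteProb d q ∂F) :=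
      mul_nonneg hc (sub_nonneg.2 hle)
    refine ⟨by linarith, fun he => ?_⟩
    have hzero : ∫ q, w q ∂F = 0 := by linarith
    have h5 := (integral_eq_zero_iff_of_nonneg_ae hw0 iw).1 hzero
    have hne : ∀ᵐ q ∂F, q ≠ c := by
      rw [ae_iff]
      simpa using h.noAtoms c
    refine integral_congr_ae ?_
    filter_upwards [h5, hweq, hne] with q h6 h7 h8
    rw [h7.2]
    rw [h7.1] at h6
    rcases mul_eq_zero.1 h6 with h9 | h9
    · exact absurd (by linarith) h8
    · linarith

/-- Optimal rules that vote as often as possible are undominated. A dominating strategy does not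
vote more often, since otherwise its whole category could adopt it; and it does not have a smaller
surplus of right over wrong votes, since the others may all vote. Hence it leads to the same
votes, and differs in its delegations only. -/
lemma Setting.isUndominated (h : Setting K M p F) {θ : ℝ × ℝ × ℝ × ℝ}
    (hθ : θ ∈ paramSet K M p)
    (hmax : ∀ D : Kind → ℝ → Kind → ℝ, (∀ k, IsRule K M k (D k)) →
        ruleValue K M p F (paramRules p θ) ≤ ruleValue K M p F D →
        totalVoteProb p F D ≤ totalVoteProb p F (paramRules p θ)) :
    IsUndominated (1 / 2) p F (ruleProfile (fun v : Voter K M => paramRules p θ (kind v))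
      fun v => h.isRule_paramRules hθ (kind v)) := by
  rintro v ⟨s', hs⟩
  have hD := h.isRule_paramRules hθ
  change WeaklyDominates (1 / 2) p F v s'
    (ruleStrategy v (paramRules p θ (kind v)) (hD (kind v))) at hs
  refine h.not_weaklyDominates ?_ hs
  have hdr : IsRule K M (kind v) (averageRule s'.prob) := isRule_averageRule s'
  have hle : ∫ q, voteProb (averageRule s'.prob) q ∂precisionLaw p F (kind v) ≤
      ∫ q, voteProb (paramRules p θ (kind v)) q ∂precisionLaw p F (kind v) := by
    have h1 := hmax _ (isRule_update hD hdr) (h.ruleValue_le_of_weaklyDominates hD hs)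
    simp only [totalVoteProb] at h1
    rw [← Finset.add_sum_erase _ _ (Finset.mem_univ (kind v)),
      ← Finset.add_sum_erase _ _ (Finset.mem_univ (kind v)), Function.update_self] at h1
    rw [Finset.sum_congr rfl (g := fun k => ∫ q, voteProb (paramRules p θ k) q ∂precisionLaw p F k)]
      at h1
    · exact le_of_add_le_add_right h1
    · intro k hk
      rw [Function.update_of_ne (Finset.ne_of_mem_erase hk)]
  obtain ⟨hsub, hsub'⟩ := h.vote_sub_le_paramRules hθ hdr hle
  obtain ⟨e, u, hev, huv, heu⟩ := h.exists_two_others v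
  have hpiv := payoff_sincere_vote_lt (fun w : Voter K M => meanPrecision p F (kind w))
    h.odd_total (fun w => h.meanPrecision_pos _) (fun w => h.meanPrecision_lt_one _) hev huv heu
  simp only [← h.ruleVector_alwaysVote] at hpiv
  rw [← profileMoments_ruleProfile p F (fun _ : Voter K M => alwaysVote)
    fun v => isRule_alwaysVote (kind v)] at hpiv
  have hgain := h.vote_sub_le_of_dominates (profileMoments_ruleProfile_false p F _ _) hpiv hs
  have hs0 : averageMoments (precisionLaw p F (kind v))
      (ruleStrategy v (paramRules p θ (kind v)) (hD (kind v))).prob =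
      ruleVector (precisionLaw p F (kind v)) (paramRules p θ (kind v)) :=
    averageMoments_ruleProb _ _
  rw [hs0] at hgain ⊢
  have h1 := h.averageMoments_vote_add s'
  have h2 := h.averageMoments_vote_le s'
  have h3 := h.ruleVector_vote_sub hdr
  have h4 := h.ruleVector_vote_add hdr
  have h5 := h.ruleVector_vote_sub (hD (kind v))
  have h6 := h.ruleVector_vote_add (hD (kind v))
  have h7 := hsub' (le_antisymm hsub (by linarith))
  intro d
  cases d <;> linarith

lemma Setting.delegationProb_ruleProfile (h : Setting K M p F) (D : Voter K M → ℝ → Kind → ℝ)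
    (hD : ∀ v, IsRule K M (kind v) (D v)) (v : Voter K M) :
    delegationProb (1 / 2) p F (ruleProfile D hD) v =
      1 - ∫ q, voteProb (D v) q ∂precisionLaw p F (kind v) := by
  have h1 : ∀ ω q, ∑ σ, signalProb q ω σ *
      ∑ k, ((ruleProfile D hD) v).prob q σ (.delegate k) = 1 - voteProb (D v) q := by
    intro ω q
    have h2 : ∀ σ, ∑ k, ((ruleProfile D hD) v).prob q σ (.delegate k) =
        1 - voteProb (D v) q := by
      intro σ
      rw [sum_kind]
      change D v q .expert + D v q .nonExpert = _
      simp only [voteProb]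
      ring
    simp only [h2]
    rw [← Finset.sum_mul, sum_signalProb, one_mul]
  unfold delegationProb
  simp only [h1]
  rw [← Finset.sum_mul, integral_sub (integrable_const _) (h.integrable_voteProb (hD v))]
  simp [prior]

/-- A rule under which voting is almost certain is as good as never delegating. -/
lemma Setting.ruleVector_eq_of_integral_voteProb (h : Setting K M p F) {k : Kind}
    {d : ℝ → Kind → ℝ} (hd : IsRule K M k d) (h1 : 1 ≤ ∫ q, voteProb d q ∂precisionLaw p F k) :
    ruleVector (precisionLaw p F k) d = sincereVector (meanPrecision p F k) := by
  have i1 := h.integrable_voteProb (k := k) hd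
  have h0 : ∫ q, (1 - voteProb d q) ∂precisionLaw p F k = 0 := by
    refine le_antisymm ?_ (integral_nonneg fun q => sub_nonneg.2 (hd.voteProb_le_one q))
    rw [integral_sub (integrable_const _) i1]
    simpa using h1
  have h2 := (integral_eq_zero_iff_of_nonneg (fun q => sub_nonneg.2 (hd.voteProb_le_one q))
    ((integrable_const 1).sub i1)).1 h0
  have h3 : ∀ᵐ q ∂precisionLaw p F k, voteProb d q = 1 ∧ ∀ j, d q j = 0 := by
    filter_upwards [h2] with q hq
    have hv : voteProb d q = 1 := by
      simp only [Pi.zero_apply] at hq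
      linarith
    have he := hd.nonneg q .expert
    have hn := hd.nonneg q .nonExpert
    refine ⟨hv, fun j => ?_⟩
    simp only [voteProb] at hv
    cases j <;> linarith
  rw [← h.ruleVector_alwaysVote]
  funext x
  cases x with
  | vote c =>
    refine integral_congr_ae (h3.mono fun q hq => ?_)
    simp only [hq.1, voteProb_alwaysVote]
  | delegate j => exact integral_congr_ae (h3.mono fun q hq => hq.2 j)

end Undominated

end LiquidDemocracy

open LiquidDemocracy
theorem mainTheorem1 (N K M : ℕ) (hNKM : N = K + M) (hN : Odd N) (hK : Odd K) (hM : 0 < M)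
    (π p : ℝ) (hπ : π = 1 / 2) (hp : 1 / 2 < p) (hp1 : p < 1)
    (F : MeasureTheory.Measure ℝ) [MeasureTheory.IsProbabilityMeasure F]
    (hF0 : ∀ x, F {x} = 0) (hF : F.support = Set.Icc (1 / 2) p) :
    ∃ s : Profile K M,
      IsEquilibrium π p F s ∧
      (∃ v, 0 < delegationProb π p F s v) ∧
      majorityVotingUtility K M π p F < expectedUtility π p F s := by
  subst hπ hNKM
  have h : Setting K M p F := ⟨hN, hK, hM, hp, hp1, hF0, hF⟩
  obtain ⟨θ, hθ, hopt, hmax⟩ := h.exists_isOptimal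
  have hD := h.isRule_paramRules hθ
  have hlt : majorityVotingUtility K M (1 / 2) p F < ruleValue K M p F (paramRules p θ) := by
    rw [h.majorityVotingUtility_eq]
    by_contra! hle
    exact h.not_isOptimal_of_sincere hopt hle
  refine ⟨ruleProfile (fun v => paramRules p θ (kind v)) fun v => hD (kind v),
    ⟨h.isPerfectBayesian hθ hopt, h.isUndominated hθ hmax, ?_, ?_, ?_⟩, ?_, ?_⟩
  · intro v w hvw q _ σ x
    change ruleProb (paramRules p θ (kind v)) q σ x = ruleProb (paramRules p θ (kind w)) q σ x
    rw [hvw]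
  · intro v q _ σ
    change (if (!σ) = σ then _ else (0 : ℝ)) = 0
    cases σ <;> rfl
  · exact fun v q _ σ σ' k => rfl
  · -- If nobody delegated, the outcome would be that of majority voting.
    by_contra! hno
    refine hlt.ne ?_
    rw [h.majorityVotingUtility_eq]
    unfold ruleValue
    congr 1
    funext v
    refine (h.ruleVector_eq_of_integral_voteProb (hD _) ?_).symm
    have := hno v
    rw [h.delegationProb_ruleProfile] at this
    linarith
  · rw [h.expectedUtility_ruleProfile]
    exact hlt
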